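/- Let $E$ be a Polish space, let $\mathcal P(E)$ be the set of Borel probability measures on $E$ with the topology of weak convergence, and let $B(E^n)$ be the set of bounded Borel measurable functions $E^n\to\mathbb R$. Let $\alpha:\mathcal P(E)\to(-\infty,\infty]$ be convex, not identically $\infty$, and such that $\{\nu:\alpha(\nu)\le c\}$ is compact for every $c\in\mathbb R$. For $n\ge 1$ and $\nu\in\mathcal P(E^n)$, write $$\nu(dx_1,\dots,dx_n)=\nu_{0,1}(dx_1)\prod_{k=2}^n\nu_{k-1,k}(x_1,\dots,x_{k-1})(dx_k)$$ for the disintegration of $\nu$, that is, $\nu_{0,1}$ is the law of the first coordinate and $\nu_{k-1,k}(x_1,\dots,x_{k-1})$ is the conditional law of the $k$-th coordinate given the first $k-1$. Define $$\alpha_n(\nu)=\int_{E^n}\sum_{k=1}^n\alpha\big(\nu_{k-1,k}(x_1,\dots,x_{k-1})\big)\,\nu(dx_1,\dots,dx_n),\qquad \rho_n(f)=\sup_{\nu\in\mathcal P(E^n)}\Big(\int_{E^n}f\,d\nu-\alpha_n(\nu)\Big)\quad(f\in B(E^n)),$$ and let $\rho(g)=\sup_{\nu\in\mathcal P(E)}\big(\int_E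 g\,d\nu-\alpha(\nu)\big)$ for $g\in B(E)$ and $\mathcal A=\{g\in B(E):\rho(g)\le 0\}$. Let $\mathcal A_n$ be the set of all $(Y_1,\dots,Y_n)$ in which each $Y_k:E^k\to\mathbb R$ is Borel measurable and $Y_k(x_1,\dots,x_{k-1},\cdot)\in\mathcal A$ for all $x_1,\dots,x_{k-1}\in E$. **Theorem.** For every $n\ge1$ and $f\in B(E^n)$, the value $\rho_n(f)$ is finite and $$\rho_n(f)=\inf\Big\{y\in\mathbb R:\ \exists\,(Y_k)_{k=1}^n\in\mathcal A_n\ \text{ such that }\ f(x_1,\dots,x_n)\le y+\sum_{k=1}^nY_k(x_1,\dots,x_k)\ \text{ for all }(x_1,\dots,x_n)\in E^n\Big\}.$$ Moreover, the infimum is attained. -/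

import Mathlib

open MeasureTheory ProbabilityTheory
open scoped NNReal ENNReal

noncomputable section

/-- The integral of an extended-real-valued function: the integral of the positive part minus the
integral of the negative part, in `[-∞, ∞]` (with `∞ - ∞ = -∞`). For a measurable function that is
bounded from below and a probability measure this is the usual integral in `(-∞, ∞]`. -/
def extIntegral {X : Type*} [MeasurableSpace X] (ν : Measure X) (φ : X → EReal) : EReal :=
  ((∫⁻ x, (φ x).toENNReal ∂ν : ℝ≥0∞) : EReal) - ((∫⁻ x, (-φ x).toENNReal ∂ν : ℝ≥0∞) : EReal)

/-- The standing assumptions on `α : 𝒫(E) → (-∞, ∞]`: it never takes the value `-∞`, it is proper,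
convex, and its sub-level sets are compact for the topology of weak convergence. -/
structure IsPenalty {E : Type*} [TopologicalSpace E] [MeasurableSpace E] [BorelSpace E]
    (α : ProbabilityMeasure E → EReal) : Prop where
  ne_bot : ∀ ν, α ν ≠ ⊥
  proper : ∃ ν, α ν ≠ ⊤
  convex : ∀ (a b : ℝ≥0), a + b = 1 → ∀ μ ν π : ProbabilityMeasure E,
    (π : Measure E) = a • (μ : Measure E) + b • (ν : Measure E) →
      α π ≤ ((a : ℝ) : EReal) * α μ + ((b : ℝ) : EReal) * α ν
  isCompact_sublevel : ∀ c : ℝ, IsCompact {ν | α ν ≤ (c : EReal)}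

/-- The convex conjugate `f ↦ sup_ν (∫ f dν - a(ν))` of a functional `a` of probability measures,
to be used for bounded measurable `f`. -/
def conjugate {X : Type*} [MeasurableSpace X] (a : ProbabilityMeasure X → EReal) (f : X → ℝ) :
    EReal :=
  ⨆ ν : ProbabilityMeasure X, (((∫ x, f x ∂(ν : Measure X) : ℝ) : EReal) - a ν)

/-- The first `m` coordinates of `x ∈ E^n`, for `m ≤ n`. -/
def firstCoords {E : Type*} {n : ℕ} (m : ℕ) (h : m ≤ n) (x : Fin n → E) : Fin m → E :=
  fun i => x (Fin.castLE h i)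

/-- The disintegration kernels of a probability measure `ν` on `E^n`. With the coordinates numbered
from `0`, `disint ν k p` is the conditional law of the coordinate `k`, given that the coordinates
before it are `p`; for `k = 0` there is nothing to condition on, and it is the law of the first
coordinate. -/
def disint {E : Type*} [MeasurableSpace E] [StandardBorelSpace E] [Nonempty E] {n : ℕ}
    (ν : ProbabilityMeasure (Fin n → E)) (k : Fin n) (p : Fin k → E) : ProbabilityMeasure E :=
  ⟨condDistrib (fun x : Fin n → E => x k) (firstCoords (k : ℕ) k.isLt.le) (ν : Measure (Fin n → E))
    p, inferInstance⟩

/-- `α_n(ν) = ∫ ∑ₖ α(ν_{k-1,k}(x₁, …, x_{k-1})) ν(dx)`. -/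
def alphaN {E : Type*} [MeasurableSpace E] [StandardBorelSpace E] [Nonempty E]
    (α : ProbabilityMeasure E → EReal) (n : ℕ) (ν : ProbabilityMeasure (Fin n → E)) : EReal :=
  extIntegral (ν : Measure (Fin n → E)) fun x =>
    ∑ k : Fin n, α (disint ν k (firstCoords (k : ℕ) k.isLt.le x))

/-- `ρ_n`, the convex conjugate of `α_n`. -/
def rhoN {E : Type*} [MeasurableSpace E] [StandardBorelSpace E] [Nonempty E]
    (α : ProbabilityMeasure E → EReal) (n : ℕ) (f : (Fin n → E) → ℝ) : EReal :=
  conjugate (alphaN α n) f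

/-- The acceptance set: the bounded measurable `g : E → ℝ` with `ρ(g) ≤ 0`, where `ρ` is the convex
conjugate of `α`. -/
def acceptanceSet {E : Type*} [MeasurableSpace E] (α : ProbabilityMeasure E → EReal) :
    Set (E → ℝ) :=
  {g | Measurable g ∧ (∃ C : ℝ, ∀ z, |g z| ≤ C) ∧ conjugate α g ≤ 0}

/-- The admissible sequences `(Y₁, …, Y_n)`: each `Y_k : E^k → ℝ` is measurable, and all its
sections in the last variable lie in the acceptance set. (Here `Y k` with `k : Fin n` stands for
`Y_{k+1}`, and `Fin.snoc p z` is the point `(p, z)` of `E^{k+1}`.) -/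
def IsAdmissible {E : Type*} [MeasurableSpace E] (α : ProbabilityMeasure E → EReal) {n : ℕ}
    (Y : (k : Fin n) → (Fin ((k : ℕ) + 1) → E) → ℝ) : Prop :=
  ∀ k : Fin n, Measurable (Y k) ∧
    ∀ p : Fin (k : ℕ) → E,
      (fun z : E => Y k (Fin.snoc (α := fun _ => E) p z)) ∈ acceptanceSet α

end

open Filter Topology

/-! Formally, `rhoN` is obtained by applying the conjugate `ρ` of `α` backwards, one variable at a
time. For a Borel function `g` the result `condRho α g` need not be Borel, so the backward recursion
is run with measurable majorants: this is `IsDominated`. Domination of `f` at level `y` is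
equivalent to superhedging with initial value `y`: the increments of the recursion are the `Y k`
(`exists_admissible`, `of_admissible`). Weak duality follows by disintegrating an arbitrary `ν` and
applying `∫ w dμ - ρ(w) ≤ α(μ)` to each conditional law (`rhoN_le`).

Strong duality holds first for decreasing limits `u` of uniformly bounded Lipschitz functions. This
class is stable under `condRho`. Compact sub-level sets provide maximizers, which can be selected
measurably (`exists_kernel`) and glued into a law on `E^n` that achieves `iterRho α n u`.

The passage to Borel `f` is Choquet's capacitability argument. By Fatou's lemma for `ρ`, domination
survives limits from below (`isDominated_of_le_liminf`). Hence, if `f` is not dominated at level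
`y`, there are Lipschitz functions `c j`, not dominated at `y` either, that decrease to some `u ≤ f`
(`exists_isLipschitzApprox_of_not`). Then `y ≤ iterRho α n (c j)` for all `j`, and in the limit `y ≤
iterRho α n u ≤ rhoN α n f`. So `f` is dominated at every level above `rhoN α n f`, and by the Fatou
property at that level itself; this is attainment. -/

/-- Proper functionals of probability measures whose sub-level sets are compact. -/
structure IsCompactPenalty {E : Type*} [TopologicalSpace E] [MeasurableSpace E] [OpensMeasurableSpace E]
    (α : ProbabilityMeasure E → EReal) : Prop where
  ne_bot : ∀ ν, α ν ≠ ⊥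
  proper : ∃ ν, α ν ≠ ⊤
  isCompact_sublevel : ∀ c : ℝ, IsCompact {ν | α ν ≤ (c : EReal)}

theorem IsPenalty.isCompactPenalty {E : Type*} [TopologicalSpace E] [MeasurableSpace E] [BorelSpace E]
    {α : ProbabilityMeasure E → EReal} (h : IsPenalty α) : IsCompactPenalty α :=
  ⟨h.ne_bot, h.proper, h.isCompact_sublevel⟩

/-- The real value of the conjugate. -/
noncomputable def rho {X : Type*} [MeasurableSpace X] (a : ProbabilityMeasure X → EReal)
    (f : X → ℝ) : ℝ := (conjugate a f).toReal

theorem abs_integral_le_of_abs_le {X : Type*} [MeasurableSpace X] {ν : Measure X}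
    [IsProbabilityMeasure ν] {f : X → ℝ} {C : ℝ} (h : ∀ x, |f x| ≤ C) : |∫ x, f x ∂ν| ≤ C := by
  have := norm_integral_le_of_norm_le_const (μ := ν) (f := f) (C := C) (ae_of_all _ h)
  simpa using this

theorem integrable_of_abs_le {X : Type*} [MeasurableSpace X] {ν : Measure X}
    [IsFiniteMeasure ν] {f : X → ℝ} {C : ℝ} (hf : Measurable f) (h : ∀ x, |f x| ≤ C) :
    Integrable f ν :=
  Integrable.of_bound hf.aestronglyMeasurable C (ae_of_all _ h)

/-! ### Conjugates of penalties with compact sub-level sets -/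

namespace IsCompactPenalty

section basic

variable {E : Type*} [TopologicalSpace E] [MeasurableSpace E] [BorelSpace E]
  [HasOuterApproxClosed E] {α : ProbabilityMeasure E → EReal}

/-- Otherwise the sub-level sets at `-k` are nested, nonempty and compact, and a common point would
have penalty `⊥`. -/
theorem exists_lower_bound (hα : IsCompactPenalty α) : ∃ m : ℝ, ∀ ν, (m : EReal) ≤ α ν := by
  by_contra! hcon
  obtain ⟨ν, hν⟩ := IsCompact.nonempty_iInter_of_sequence_nonempty_isCompact_isClosed
    (fun k : ℕ => {ν | α ν ≤ ((-(k : ℝ) : ℝ) : EReal)})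
    (fun k ν (hν : α ν ≤ _) => hν.trans (by
      rw [EReal.coe_le_coe_iff]; push_cast; linarith))
    (fun k => by obtain ⟨ν, hν⟩ := hcon (-(k : ℝ)); exact ⟨ν, hν.le⟩)
    (hα.isCompact_sublevel _) (fun k => (hα.isCompact_sublevel _).isClosed)
  refine hα.ne_bot ν ?_
  rw [EReal.eq_bot_iff_forall_lt]
  intro y
  obtain ⟨k, hk⟩ := exists_nat_gt (-y)
  refine (Set.mem_iInter.1 hν k).trans_lt ?_
  rw [EReal.coe_lt_coe_iff]; linarith

theorem conjugate_eq_coe (hα : IsCompactPenalty α) {w : E → ℝ} {C : ℝ} (hw : ∀ x, |w x| ≤ C) :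
    conjugate α w = (rho α w : EReal) := by
  obtain ⟨m, hm⟩ := hα.exists_lower_bound
  refine (EReal.coe_toReal ?_ ?_).symm
  · refine ne_top_of_le_ne_top (EReal.coe_ne_top (C - m)) (iSup_le fun ν => ?_)
    rw [EReal.coe_sub]
    exact EReal.sub_le_sub (EReal.coe_le_coe_iff.2 (abs_le.1 (abs_integral_le_of_abs_le hw)).2)
      (hm ν)
  · obtain ⟨ν, hν⟩ := hα.proper
    refine ne_bot_of_le_ne_bot ?_ (le_iSup _ ν)
    lift α ν to ℝ using ⟨hν, hα.ne_bot ν⟩ with t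
    rw [← EReal.coe_sub]
    exact EReal.coe_ne_bot _

/-- In this form the subtraction takes place in `ℝ`, so the value `⊤` of `α` needs no care later. -/
theorem rho_le_iff (hα : IsCompactPenalty α) {w : E → ℝ} {C : ℝ} (hw : ∀ x, |w x| ≤ C) {r : ℝ} :
    rho α w ≤ r ↔ ∀ ν : ProbabilityMeasure E, ((∫ x, w x ∂(ν : Measure E) - r : ℝ) : EReal) ≤ α ν := by
  rw [← EReal.coe_le_coe_iff, ← hα.conjugate_eq_coe hw, conjugate, iSup_le_iff]
  refine forall_congr' fun ν => ?_
  have hb := hα.ne_bot ν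
  induction h : α ν with
  | bot => exact absurd h hb
  | top => simp
  | coe t => rw [← EReal.coe_sub, EReal.coe_le_coe_iff, EReal.coe_le_coe_iff]; constructor <;> intro _ <;> linarith

theorem integral_sub_rho_le (hα : IsCompactPenalty α) {w : E → ℝ} {C : ℝ} (hw : ∀ x, |w x| ≤ C)
    (ν : ProbabilityMeasure E) : ((∫ x, w x ∂(ν : Measure E) - rho α w : ℝ) : EReal) ≤ α ν :=
  (hα.rho_le_iff hw).1 le_rfl ν

theorem rho_le_add (hα : IsCompactPenalty α) {v w : E → ℝ} {C D δ : ℝ} (hv : ∀ x, |v x| ≤ C)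
    (hw : ∀ x, |w x| ≤ D) (hvm : Measurable v) (hwm : Measurable w) (h : ∀ x, v x ≤ w x + δ) :
    rho α v ≤ rho α w + δ := by
  refine (hα.rho_le_iff hv).2 fun ν => le_trans ?_ (hα.integral_sub_rho_le hw ν)
  rw [EReal.coe_le_coe_iff]
  have h1 : ∫ x, v x ∂(ν : Measure E) ≤ ∫ x, (w x + δ) ∂(ν : Measure E) :=
    integral_mono (integrable_of_abs_le hvm hv)
      ((integrable_of_abs_le hwm hw).add (integrable_const _)) h
  rw [integral_add (integrable_of_abs_le hwm hw) (integrable_const _)] at h1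
  simp at h1
  linarith

theorem rho_mono (hα : IsCompactPenalty α) {v w : E → ℝ} {C D : ℝ} (hv : ∀ x, |v x| ≤ C)
    (hw : ∀ x, |w x| ≤ D) (hvm : Measurable v) (hwm : Measurable w) (h : ∀ x, v x ≤ w x) :
    rho α v ≤ rho α w := by
  simpa using hα.rho_le_add hv hw hvm hwm (δ := 0) (by simpa using h)

theorem abs_rho_le (hα : IsCompactPenalty α) {w : E → ℝ} {C : ℝ} (hw : ∀ x, |w x| ≤ C)
    (hwm : Measurable w) : |rho α w| ≤ C + |rho α (fun _ => 0)| := by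
  have h0 : ∀ x : E, |(fun _ => (0 : ℝ)) x| ≤ 0 := by simp
  have h1 := hα.rho_le_add (δ := C) hw h0 hwm measurable_const
    fun x => by simpa using (abs_le.1 (hw x)).2
  have h2 := hα.rho_le_add (δ := C) h0 hw measurable_const hwm
    fun x => by have := (abs_le.1 (hw x)).1; simp; linarith
  rw [abs_le]
  constructor
  · linarith [neg_abs_le (rho α (fun _ => (0 : ℝ)))]
  · linarith [le_abs_self (rho α (fun _ => (0 : ℝ)))]

/-- Fatou's lemma for the conjugate. -/
theorem rho_liminf_le (hα : IsCompactPenalty α) {w : ℕ → E → ℝ} {C : ℝ} (hw : ∀ j x, |w j x| ≤ C)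
    (hwm : ∀ j, Measurable (w j)) :
    rho α (fun x => liminf (fun j => w j x) atTop) ≤ liminf (fun j => rho α (w j)) atTop := by
  have hlow : ∀ j x, -C ≤ w j x := fun j x => (abs_le.1 (hw j x)).1
  have hup : ∀ j x, w j x ≤ C := fun j x => (abs_le.1 (hw j x)).2
  have hbb : ∀ x j, BddBelow (Set.range fun i => w (i + j) x) := fun x j =>
    ⟨-C, by rintro _ ⟨i, rfl⟩; exact hlow _ _⟩
  -- The tail infima `G j` increase to the liminf and lie below `w j`; for fixed `ν`, dominated
  -- convergence for `G` replaces Fatou's lemma.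
  set G : ℕ → E → ℝ := fun j x => ⨅ i, w (i + j) x with hG
  have hGm : ∀ j, Measurable (G j) := fun j => Measurable.iInf fun i => hwm _
  have hGle : ∀ i j x, j ≤ i → G j x ≤ w i x := fun i j x hij => by
    have := ciInf_le (hbb x j) (i - j)
    rwa [Nat.sub_add_cancel hij] at this
  have hGC : ∀ j x, |G j x| ≤ C := fun j x => abs_le.2
    ⟨le_ciInf fun i => hlow _ _, (hGle j j x le_rfl).trans (hup j x)⟩
  have hGt : ∀ x, Tendsto (fun j => G j x) atTop (𝓝 (liminf (fun j => w j x) atTop)) := fun x => by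
    have hmono : Monotone fun j => G j x := fun j k hjk =>
      le_ciInf fun i => hGle _ _ _ (by omega)
    have hbdd : BddAbove (Set.range fun j => G j x) :=
      ⟨C, by rintro _ ⟨i, rfl⟩; exact (abs_le.1 (hGC i x)).2⟩
    have heq : liminf (fun j => w j x) atTop = ⨆ j, G j x := by
      refine le_antisymm (liminf_le_of_le (isBoundedUnder_of ⟨-C, fun j => hlow j x⟩) fun b hb => ?_)
        (ciSup_le fun j => le_liminf_of_le
          (isBoundedUnder_of ⟨C, fun j => hup j x⟩).isCoboundedUnder_ge
          ((eventually_ge_atTop j).mono fun i hi => hGle i j x hi))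
      obtain ⟨N, hN⟩ := eventually_atTop.1 hb
      exact (le_ciInf fun i => hN _ (Nat.le_add_left N i)).trans (le_ciSup hbdd N)
    rw [heq]
    exact tendsto_atTop_ciSup hmono hbdd
  have hliC : ∀ x, |liminf (fun j => w j x) atTop| ≤ C := fun x =>
    le_of_tendsto ((hGt x).abs) (Eventually.of_forall fun j => hGC j x)
  have hR : ∀ j, |rho α (w j)| ≤ C + |rho α (fun _ => 0)| := fun j => hα.abs_rho_le (hw j) (hwm j)
  refine (hα.rho_le_iff hliC).2 fun ν => ?_
  induction h : α ν with
  | bot => exact absurd h (hα.ne_bot ν)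
  | top => exact le_top
  | coe t =>
    rw [EReal.coe_le_coe_iff]
    have hint : Tendsto (fun j => ∫ x, G j x ∂(ν : Measure E)) atTop
        (𝓝 (∫ x, liminf (fun j => w j x) atTop ∂(ν : Measure E))) :=
      tendsto_integral_of_dominated_convergence (fun _ => C)
        (fun j => (hGm j).aestronglyMeasurable) (integrable_const _)
        (fun j => ae_of_all _ (hGC j)) (ae_of_all _ hGt)
    have key : ∀ j, (∫ x, G j x ∂(ν : Measure E)) - t ≤ rho α (w j) := fun j => by
      have h1 := hα.integral_sub_rho_le (hw j) ν
      rw [h, EReal.coe_le_coe_iff] at h1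
      have h2 : ∫ x, G j x ∂(ν : Measure E) ≤ ∫ x, w j x ∂(ν : Measure E) :=
        integral_mono (integrable_of_abs_le (hGm j) (hGC j))
          (integrable_of_abs_le (hwm j) (hw j)) fun x => hGle j j x le_rfl
      linarith
    have h3 : liminf (fun j => (∫ x, G j x ∂(ν : Measure E)) - t) atTop
        ≤ liminf (fun j => rho α (w j)) atTop :=
      liminf_le_liminf (Eventually.of_forall key)
        (hint.sub_const t).isBoundedUnder_ge
        (isBoundedUnder_of ⟨C + |rho α (fun _ => 0)|, fun j => (abs_le.1 (hR j)).2⟩).isCoboundedUnder_ge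
    rw [(hint.sub_const t).liminf_eq] at h3
    linarith

/-- The penalty is lower semicontinuous and the integral is continuous, so the set is closed; the
bound on `w` puts it inside the sub-level set at `C - r`. -/
theorem isCompact_setOf_le_integral_sub (hα : IsCompactPenalty α) {w : E → ℝ} {C : ℝ}
    (hw : Continuous w) (hC : ∀ x, |w x| ≤ C) (r : ℝ) :
    IsCompact {ν : ProbabilityMeasure E |
      α ν ≤ ((∫ x, w x ∂(ν : Measure E) - r : ℝ) : EReal)} := by
  have hcont : Continuous fun ν : ProbabilityMeasure E => ∫ x, w x ∂(ν : Measure E) := by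
    rw [continuous_iff_continuousAt]
    intro ν
    exact ProbabilityMeasure.tendsto_iff_forall_integral_tendsto.1 tendsto_id
      (BoundedContinuousFunction.ofNormedAddCommGroup w hw C hC)
  refine (hα.isCompact_sublevel (C - r)).of_isClosed_subset ?_ fun ν hν => ?_
  · have : {ν : ProbabilityMeasure E | α ν ≤ ((∫ x, w x ∂(ν : Measure E) - r : ℝ) : EReal)} =
        ⋂ q : ℝ, ({ν | α ν ≤ (q : EReal)} ∪
          {ν : ProbabilityMeasure E | q ≤ ∫ x, w x ∂(ν : Measure E) - r}) := by
      ext ν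
      simp only [Set.mem_ofPred_eq, Set.mem_iInter, Set.mem_union]
      constructor
      · intro h q
        rcases le_total q (∫ x, w x ∂(ν : Measure E) - r) with hq | hq
        · exact Or.inr hq
        · exact Or.inl (h.trans (EReal.coe_le_coe_iff.2 hq))
      · intro h
        refine EReal.le_of_forall_lt_iff_le.1 fun q hq => ?_
        exact (h q).resolve_right (not_le.2 (EReal.coe_lt_coe_iff.1 hq))
    rw [this]
    exact isClosed_iInter fun q => (hα.isCompact_sublevel q).isClosed.union
      (isClosed_le continuous_const (hcont.sub continuous_const))
  · refine le_trans hν (EReal.coe_le_coe_iff.2 ?_)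
    linarith [(abs_le.1 (abs_integral_le_of_abs_le (ν := (ν : Measure E)) hC)).2]

/-- For a decreasing limit of bounded continuous functions, the conjugate is attained, and it is
the limit of the conjugates. -/
theorem exists_eq_and_tendsto_rho (hα : IsCompactPenalty α) {c : ℕ → E → ℝ} {u : E → ℝ} {C : ℝ}
    (hcont : ∀ j, Continuous (c j)) (hC : ∀ j x, |c j x| ≤ C) (hanti : ∀ x, Antitone fun j => c j x)
    (hlim : ∀ x, Tendsto (fun j => c j x) atTop (𝓝 (u x))) :
    (∃ ν : ProbabilityMeasure E, α ν = ((∫ x, u x ∂(ν : Measure E) - rho α u : ℝ) : EReal)) ∧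
      Tendsto (fun j => rho α (c j)) atTop (𝓝 (rho α u)) := by
  have hum : Measurable u := measurable_of_tendsto_metrizable (fun j => (hcont j).measurable)
    (tendsto_pi_nhds.2 hlim)
  have huC : ∀ x, |u x| ≤ C := fun x =>
    le_of_tendsto ((hlim x).abs) (Eventually.of_forall fun j => hC j x)
  have hule : ∀ j x, u x ≤ c j x := fun j x => (hanti x).le_of_tendsto (hlim x) j
  have hranti : Antitone fun j => rho α (c j) := fun i j hij =>
    hα.rho_mono (hC j) (hC i) (hcont j).measurable (hcont i).measurable fun x => hanti x hij
  have hrle : ∀ j, rho α u ≤ rho α (c j) := fun j =>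
    hα.rho_mono huC (hC j) hum (hcont j).measurable (hule j)
  have hrt : Tendsto (fun j => rho α (c j)) atTop (𝓝 (⨅ j, rho α (c j))) :=
    tendsto_atTop_ciInf hranti ⟨rho α u, by rintro _ ⟨j, rfl⟩; exact hrle j⟩
  set R := ⨅ j, rho α (c j) with hRdef
  have hRle : ∀ j, R ≤ rho α (c j) := fun j => hranti.le_of_tendsto hrt j
  have huR : rho α u ≤ R := le_ciInf hrle
  have hint : ∀ ν : ProbabilityMeasure E, Tendsto (fun j => ∫ x, c j x ∂(ν : Measure E)) atTop
      (𝓝 (∫ x, u x ∂(ν : Measure E))) := fun ν =>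
    tendsto_integral_of_dominated_convergence (fun _ => C)
      (fun j => (hcont j).measurable.aestronglyMeasurable) (integrable_const _)
      (fun j => ae_of_all _ (hC j)) (ae_of_all _ hlim)
  have hcompact : ∀ (j : ℕ) (r : ℝ), IsCompact {ν : ProbabilityMeasure E |
      α ν ≤ ((∫ x, c j x ∂(ν : Measure E) - r : ℝ) : EReal)} := fun j r =>
    hα.isCompact_setOf_le_integral_sub (hcont j) (hC j) r
  -- approximate maximizers of `c j` at level `R - 1 / (j + 1)` have a common cluster point
  obtain ⟨ν, hν⟩ := IsCompact.nonempty_iInter_of_sequence_nonempty_isCompact_isClosed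
    (fun j : ℕ => {ν : ProbabilityMeasure E |
      α ν ≤ ((∫ x, c j x ∂(ν : Measure E) - (R - 1 / ((j : ℝ) + 1)) : ℝ) : EReal)})
    (fun j ν (hν : α ν ≤ _) => hν.trans (EReal.coe_le_coe_iff.2 (by
      have h1 : ∫ x, c (j + 1) x ∂(ν : Measure E) ≤ ∫ x, c j x ∂(ν : Measure E) :=
        integral_mono (integrable_of_abs_le (hcont _).measurable (hC _))
          (integrable_of_abs_le (hcont _).measurable (hC _)) fun x => hanti x (Nat.le_succ j)
      have h2 : 1 / (((j + 1 : ℕ) : ℝ) + 1) ≤ 1 / ((j : ℝ) + 1) :=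
        one_div_le_one_div_of_le (by positivity) (by push_cast; linarith)
      linarith)))
    (fun j => by
      by_contra hne
      have : rho α (c j) ≤ R - 1 / ((j : ℝ) + 1) := by
        refine (hα.rho_le_iff (hC j)).2 fun ν => ?_
        by_contra hν
        exact hne ⟨ν, (not_le.1 hν).le⟩
      have hpos : 0 < 1 / ((j : ℝ) + 1) := by positivity
      linarith [hRle j])
    (hcompact 0 _) (fun j => (hcompact j _).isClosed)
  have hν' : ∀ j : ℕ, α ν ≤ ((∫ x, c j x ∂(ν : Measure E) - (R - 1 / ((j : ℝ) + 1)) : ℝ) : EReal) :=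
    fun j => Set.mem_iInter.1 hν j
  -- Letting `j → ∞` gives `α ν ≤ ∫ u dν - R`. Together with `∫ u dν - ρ(u) ≤ α ν` this forces `R =
  -- ρ(u)`, so one `ν` yields both attainment and convergence.
  have hle : α ν ≤ ((∫ x, u x ∂(ν : Measure E) - R : ℝ) : EReal) := by
    have ht : Tendsto (fun j : ℕ => ∫ x, c j x ∂(ν : Measure E) - (R - 1 / ((j : ℝ) + 1))) atTop
        (𝓝 (∫ x, u x ∂(ν : Measure E) - (R - 0))) :=
      (hint ν).sub (tendsto_one_div_add_atTop_nhds_zero_nat.const_sub R)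
    rw [sub_zero] at ht
    exact ge_of_tendsto' ((continuous_coe_real_ereal.tendsto _).comp ht) hν'
  have hge := hα.integral_sub_rho_le huC ν
  have hRu : R = rho α u := by
    have := EReal.coe_le_coe_iff.1 (hge.trans hle)
    exact le_antisymm (by linarith) huR
  rw [hRu] at hle hrt
  exact ⟨⟨ν, le_antisymm hle hge⟩, hrt⟩

end basic

end IsCompactPenalty

/-! ### Backward domination and admissible sequences -/

section

variable {E : Type*}

/-- The section of a function on `E^(n+1)` in the last variable. -/
abbrev lastSection {n : ℕ} (g : (Fin (n + 1) → E) → ℝ) (p : Fin n → E) : E → ℝ :=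
  fun z => g (Fin.snoc (α := fun _ => E) p z)

theorem snoc_init_last {n : ℕ} (x : Fin (n + 1) → E) :
    Fin.snoc (α := fun _ => E) (fun i : Fin n => x i.castSucc) (x (Fin.last n)) = x :=
  Fin.snoc_init_self x

theorem measurable_snoc [MeasurableSpace E] {n : ℕ} :
    Measurable fun q : (Fin n → E) × E => Fin.snoc (α := fun _ => E) q.1 q.2 := by
  refine measurable_pi_iff.2 fun i => ?_
  induction i using Fin.lastCases with
  | last => simpa using measurable_snd
  | cast i =>
    simp only [Fin.snoc_castSucc]
    exact (measurable_pi_apply i).comp measurable_fst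

theorem measurable_lastSection [MeasurableSpace E] {n : ℕ} {g : (Fin (n + 1) → E) → ℝ}
    (hg : Measurable g) (p : Fin n → E) : Measurable (lastSection g p) :=
  hg.comp (measurable_snoc.comp measurable_prodMk_left)

theorem measurable_init [MeasurableSpace E] {n : ℕ} :
    Measurable fun (x : Fin (n + 1) → E) (i : Fin n) => x i.castSucc :=
  measurable_pi_iff.2 fun _ => measurable_pi_apply _

theorem measurable_firstCoords [MeasurableSpace E] {n m : ℕ} (h : m ≤ n) :
    Measurable (firstCoords (E := E) m h) :=
  measurable_pi_iff.2 fun _ => measurable_pi_apply _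

theorem firstCoords_snoc {n m : ℕ} (h : m ≤ n) (p : Fin n → E) (z : E) :
    firstCoords m (h.trans (Nat.le_succ n)) (Fin.snoc (α := fun _ => E) p z) = firstCoords m h p := by
  funext i
  exact Fin.snoc_castSucc (α := fun _ => E) z p (Fin.castLE h i)

variable [MeasurableSpace E]

/-- The conjugate of `α` applied in the last variable. -/
noncomputable def condRho (α : ProbabilityMeasure E → EReal) {n : ℕ} (g : (Fin (n + 1) → E) → ℝ)
    (p : Fin n → E) : ℝ := rho α (lastSection g p)

/-- `f` is dominated at level `y`: backwards from the last coordinate, `f` is replaced by a bounded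
measurable function above it, to which `condRho` is applied, until the constant `y` is reached. -/
def IsDominated (α : ProbabilityMeasure E → EReal) :
    (n : ℕ) → ((Fin n → E) → ℝ) → ℝ → Prop
  | 0, f, y => ∀ x, f x ≤ y
  | n + 1, f, y => ∃ g : (Fin (n + 1) → E) → ℝ, Measurable g ∧ (∃ C : ℝ, ∀ x, |g x| ≤ C) ∧
      (∀ x, f x ≤ g x) ∧ IsDominated α n (condRho α g) y

theorem IsDominated.mono {α : ProbabilityMeasure E → EReal} {n : ℕ} {f f' : (Fin n → E) → ℝ}
    {y y' : ℝ} (h : IsDominated α n f y) (hf : ∀ x, f' x ≤ f x) (hy : y ≤ y') :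
    IsDominated α n f' y' := by
  induction n with
  | zero => exact fun x => (hf x).trans ((h x).trans hy)
  | succ n ih =>
    obtain ⟨g, hgm, hgb, hfg, hD⟩ := h
    exact ⟨g, hgm, hgb, fun x => (hf x).trans (hfg x), ih hD fun _ => le_rfl⟩

variable [TopologicalSpace E] [BorelSpace E] [HasOuterApproxClosed E]
  {α : ProbabilityMeasure E → EReal}

theorem IsCompactPenalty.abs_condRho_le (hα : IsCompactPenalty α) {n : ℕ}
    {g : (Fin (n + 1) → E) → ℝ} {C : ℝ} (hg : Measurable g) (hC : ∀ x, |g x| ≤ C)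
    (p : Fin n → E) : |condRho α g p| ≤ C + |rho α (fun _ => 0)| :=
  hα.abs_rho_le (fun _ => hC _) (measurable_lastSection hg p)

/-- The liminf of measurable majorants is a measurable majorant of the liminf, and `rho_liminf_le`
carries this one variable further back. -/
theorem isDominated_of_le_liminf (hα : IsCompactPenalty α) {n : ℕ} {C : ℝ}
    {f : ℕ → (Fin n → E) → ℝ} {f' : (Fin n → E) → ℝ} {y : ℕ → ℝ} {y' : ℝ}
    (hC : ∀ j x, |f j x| ≤ C) (hD : ∀ j, IsDominated α n (f j) (y j))
    (hy : Tendsto y atTop (𝓝 y')) (hf' : ∀ x, f' x ≤ liminf (fun j => f j x) atTop) :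
    IsDominated α n f' y' := by
  induction n generalizing C with
  | zero =>
    intro x
    refine (hf' x).trans ?_
    rw [← hy.liminf_eq]
    exact liminf_le_liminf (Eventually.of_forall fun j => hD j x)
      (isBoundedUnder_of ⟨-C, fun j => (abs_le.1 (hC j x)).1⟩) hy.isCoboundedUnder_ge
  | succ n ih =>
    choose g hgm hgb hfg hgD using hD
    -- The bounds of the `g j` may depend on `j`. Capping at `C` makes them uniform, keeps `f j ≤ g
    -- j`, and only lowers `condRho`.
    have hg'C : ∀ j x, |min (g j x) C| ≤ C := fun j x => abs_le.2
      ⟨le_min ((abs_le.1 (hC j x)).1.trans (hfg j x)) (by linarith [(abs_nonneg _).trans (hC j x)]),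
        min_le_right _ _⟩
    have hg'm : ∀ j, Measurable fun x => min (g j x) C := fun j => (hgm j).min measurable_const
    have hbelow : ∀ x, IsBoundedUnder (· ≥ ·) atTop fun j => min (g j x) C := fun x =>
      isBoundedUnder_of ⟨-C, fun j => (abs_le.1 (hg'C j x)).1⟩
    have habove : ∀ x, IsBoundedUnder (· ≤ ·) atTop fun j => min (g j x) C := fun x =>
      isBoundedUnder_of ⟨C, fun j => (abs_le.1 (hg'C j x)).2⟩
    refine ⟨fun x => liminf (fun j => min (g j x) C) atTop, Measurable.liminf hg'm,
      ⟨C, fun x => abs_le.2 ⟨?_, ?_⟩⟩, fun x => ?_, ?_⟩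
    · exact le_liminf_of_le (habove x).isCoboundedUnder_ge
        (Eventually.of_forall fun j => (abs_le.1 (hg'C j x)).1)
    · refine liminf_le_of_le (hbelow x) fun b hb => ?_
      obtain ⟨j, hj⟩ := hb.exists
      exact hj.trans (min_le_right _ _)
    · refine (hf' x).trans (liminf_le_liminf (Eventually.of_forall fun j =>
        le_min (hfg j x) (abs_le.1 (hC j x)).2)
        (isBoundedUnder_of ⟨-C, fun j => (abs_le.1 (hC j x)).1⟩) (habove x).isCoboundedUnder_ge)
    · refine ih (C := C + |rho α (fun _ => 0)|) (f := fun j => condRho α fun x => min (g j x) C)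
        (fun j p => hα.abs_condRho_le (hg'm j) (hg'C j) p) (fun j => (hgD j).mono (fun p => ?_) le_rfl)
        fun p => ?_
      · obtain ⟨D, hD⟩ := hgb j
        exact hα.rho_mono (fun _ => hg'C j _) (fun _ => hD _) (measurable_lastSection (hg'm j) p)
          (measurable_lastSection (hgm j) p) fun _ => min_le_left _ _
      · exact hα.rho_liminf_le (fun j _ => hg'C j _) fun j => measurable_lastSection (hg'm j) p

/-- The last term is `Z = g - S`, where `S` is the superhedge of `condRho α g` by the earlier terms.
As `S` is constant in the last variable, `ρ` of a section of `Z` is at most `condRho α g p - S p ≤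
0`. Indexing `Y` by `ℕ` lets the induction step alter only the entry `n`. -/
theorem IsDominated.exists_admissible (hα : IsCompactPenalty α) {n : ℕ} {f : (Fin n → E) → ℝ}
    {y : ℝ} (h : IsDominated α n f y) :
    ∃ Y : (k : ℕ) → (Fin (k + 1) → E) → ℝ, IsAdmissible α (fun k : Fin n => Y k) ∧
      ∀ x : Fin n → E, f x ≤ y + ∑ k : Fin n, Y k (firstCoords ((k : ℕ) + 1) k.isLt x) := by
  induction n with
  | zero => exact ⟨fun _ _ => 0, fun k => k.elim0, fun x => by simpa using h x⟩
  | succ n ih =>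
    obtain ⟨g, hgm, ⟨C, hgC⟩, hfg, hD⟩ := h
    obtain ⟨Y, hY, hle⟩ := ih hD
    set S : (Fin n → E) → ℝ := fun p =>
      y + ∑ k : Fin n, Y k (firstCoords ((k : ℕ) + 1) k.isLt p) with hS
    have hSm : Measurable S := measurable_const.add
      (Finset.measurable_sum _ fun k _ => (hY k).1.comp (measurable_firstCoords _))
    set Z : (Fin (n + 1) → E) → ℝ := fun x => g x - S (fun i => x i.castSucc) with hZ
    have hZm : Measurable Z := hgm.sub (hSm.comp measurable_init)
    refine ⟨Function.update Y n Z, fun k => ?_, fun x => ?_⟩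
    · induction k using Fin.lastCases with
      | last =>
        simp only [Fin.val_last, Function.update_self]
        refine ⟨hZm, fun p => ?_⟩
        have hsec : ∀ z : E, Z (Fin.snoc (α := fun _ => E) p z) = lastSection g p z - S p := fun z => by
          simp [hZ, lastSection]
        have hb : ∀ z : E, |Z (Fin.snoc (α := fun _ => E) p z)| ≤ C + |S p| := fun z => by
          rw [hsec]
          exact (abs_sub _ _).trans (add_le_add_left (hgC _) _)
        have hm := measurable_lastSection hZm p
        refine ⟨hm, ⟨_, hb⟩, ?_⟩
        rw [hα.conjugate_eq_coe hb]
        have h1 := hα.rho_le_add (δ := -S p) hb (fun z => hgC _) hm (measurable_lastSection hgm p)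
          fun z => by rw [hsec]; linarith
        have h2 := hle p
        have : rho α (fun z => Z (Fin.snoc (α := fun _ => E) p z)) ≤ 0 := by
          change condRho α g p ≤ S p at h2
          unfold condRho at h2
          linarith
        exact_mod_cast this
      | cast k =>
        have hk : (k.castSucc : Fin (n + 1)).val ≠ n := k.isLt.ne
        simp only [Function.update_of_ne hk]
        exact hY k
    · rw [Fin.sum_univ_castSucc]
      have hcast : ∀ k : Fin n, Function.update Y n Z (k.castSucc : Fin (n + 1)).val
          (firstCoords ((k.castSucc : Fin (n + 1)).val + 1) k.castSucc.isLt x) =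
          Y k (firstCoords ((k : ℕ) + 1) k.isLt fun i => x i.castSucc) := fun k => by
        have hk : (k.castSucc : Fin (n + 1)).val ≠ n := k.isLt.ne
        rw [Function.update_of_ne hk]
        rfl
      have hlast : Function.update Y n Z (Fin.last n).val
          (firstCoords ((Fin.last n).val + 1) (Fin.last n).isLt x) = Z x := by
        simp only [Fin.val_last, Function.update_self]
        rfl
      rw [Finset.sum_congr rfl fun k _ => hcast k, hlast]
      have := hfg x
      simp only [hZ, hS]
      linarith

/-- The majorant is the superhedge itself, capped at `C`: the `Y k` are bounded only section by
section, whereas `IsDominated` asks for a globally bounded function. -/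
theorem IsDominated.of_admissible (hα : IsCompactPenalty α) {n : ℕ} {f : (Fin n → E) → ℝ}
    {y C : ℝ} (hC : ∀ x, |f x| ≤ C) {Y : (k : Fin n) → (Fin ((k : ℕ) + 1) → E) → ℝ}
    (hY : IsAdmissible α Y)
    (hle : ∀ x : Fin n → E, f x ≤ y + ∑ k : Fin n, Y k (firstCoords ((k : ℕ) + 1) k.isLt x)) :
    IsDominated α n f y := by
  induction n generalizing C with
  | zero => exact fun x => by simpa using hle x
  | succ n ih =>
    set S : (Fin (n + 1) → E) → ℝ := fun x =>
      y + ∑ k : Fin (n + 1), Y k (firstCoords ((k : ℕ) + 1) k.isLt x) with hS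
    have hSm : Measurable S := measurable_const.add
      (Finset.measurable_sum _ fun k _ => (hY k).1.comp (measurable_firstCoords _))
    have hgm : Measurable fun x => min (S x) C := hSm.min measurable_const
    have hgC : ∀ x, |min (S x) C| ≤ C := fun x => abs_le.2
      ⟨le_min ((abs_le.1 (hC x)).1.trans (hle x)) (by linarith [(abs_nonneg _).trans (hC x)]),
        min_le_right _ _⟩
    refine ⟨fun x => min (S x) C, hgm, ⟨C, hgC⟩, fun x => le_min (hle x) (abs_le.1 (hC x)).2, ?_⟩
    refine ih (Y := fun k => Y k.castSucc) (hα.abs_condRho_le hgm hgC) (fun k => hY k.castSucc)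
      fun p => ?_
    obtain ⟨hm, ⟨D, hD⟩, hr⟩ := (hY (Fin.last n)).2 p
    rw [hα.conjugate_eq_coe hD] at hr
    have hr' : rho α (fun z => Y (Fin.last n) (Fin.snoc (α := fun _ => E) p z)) ≤ 0 := by
      exact_mod_cast hr
    have h1 := hα.rho_le_add (δ := y + ∑ k : Fin n, Y k.castSucc (firstCoords ((k : ℕ) + 1) k.isLt p))
      (fun z => hgC _) hD (measurable_lastSection hgm p) hm fun z => by
        refine (min_le_left _ _).trans ?_
        simp only [hS]
        rw [Fin.sum_univ_castSucc]
        have hcast : ∀ k : Fin n, Y k.castSucc (firstCoords ((k.castSucc : Fin (n + 1)).val + 1)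
            k.castSucc.isLt (Fin.snoc (α := fun _ => E) p z)) =
            Y k.castSucc (firstCoords ((k : ℕ) + 1) k.isLt p) := fun k =>
          congrArg (Y k.castSucc) (firstCoords_snoc (Nat.succ_le_of_lt k.isLt) p z)
        rw [Finset.sum_congr rfl fun k _ => hcast k]
        have hlast : firstCoords ((Fin.last n).val + 1) (Fin.last n).isLt
            (Fin.snoc (α := fun _ => E) p z) = Fin.snoc (α := fun _ => E) p z := rfl
        rw [hlast]
        linarith
    change rho α _ ≤ _
    linarith

end

/-! ### Extended integrals and disintegration -/

theorem extIntegral_congr_ae {X : Type*} [MeasurableSpace X] {ν : Measure X} {φ ψ : X → EReal}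
    (h : φ =ᵐ[ν] ψ) : extIntegral ν φ = extIntegral ν ψ := by
  have h1 : ∫⁻ x, (φ x).toENNReal ∂ν = ∫⁻ x, (ψ x).toENNReal ∂ν :=
    lintegral_congr_ae (h.mono fun x hx => by simp only [hx])
  have h2 : ∫⁻ x, (-φ x).toENNReal ∂ν = ∫⁻ x, (-ψ x).toENNReal ∂ν :=
    lintegral_congr_ae (h.mono fun x hx => by simp only [hx])
  unfold extIntegral
  rw [h1, h2]

theorem extIntegral_mono {X : Type*} [MeasurableSpace X] {ν : Measure X} {φ ψ : X → EReal}
    (h : ∀ x, φ x ≤ ψ x) : extIntegral ν φ ≤ extIntegral ν ψ :=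
  EReal.sub_le_sub
    (EReal.coe_ennreal_le_coe_ennreal_iff.2
      (lintegral_mono fun x => EReal.toENNReal_le_toENNReal (h x)))
    (EReal.coe_ennreal_le_coe_ennreal_iff.2
      (lintegral_mono fun x => EReal.toENNReal_le_toENNReal (EReal.neg_le_neg_iff.2 (h x))))

theorem extIntegral_coe {X : Type*} [MeasurableSpace X] {ν : Measure X} {ψ : X → ℝ}
    (h : Integrable ψ ν) : extIntegral ν (fun x => (ψ x : EReal)) = ((∫ x, ψ x ∂ν : ℝ) : EReal) := by
  have h1 : ∫⁻ x, (ψ x : EReal).toENNReal ∂ν ≠ ⊤ := by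
    simpa using h.lintegral_lt_top.ne
  have h2 : ∫⁻ x, (-(ψ x : EReal)).toENNReal ∂ν ≠ ⊤ := by
    have := h.neg.lintegral_lt_top.ne
    simpa [← EReal.coe_neg] using this
  unfold extIntegral
  rw [integral_eq_lintegral_pos_part_sub_lintegral_neg_part h]
  lift ∫⁻ x, (ψ x : EReal).toENNReal ∂ν to ℝ≥0 using h1 with a ha
  lift ∫⁻ x, (-(ψ x : EReal)).toENNReal ∂ν to ℝ≥0 using h2 with b hb
  simp only [← EReal.coe_neg, EReal.toENNReal_of_ne_top (EReal.coe_ne_top _), EReal.toReal_coe]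
    at ha hb
  rw [← ha, ← hb]
  simp
  rfl

section

variable {E : Type*} [MeasurableSpace E]

/-- The law of the first `n` coordinates. -/
noncomputable def initLaw {n : ℕ} (ν : ProbabilityMeasure (Fin (n + 1) → E)) :
    ProbabilityMeasure (Fin n → E) :=
  ν.map (f := fun x i => x i.castSucc) measurable_init.aemeasurable

theorem coe_initLaw {n : ℕ} (ν : ProbabilityMeasure (Fin (n + 1) → E)) :
    (initLaw ν : Measure (Fin n → E)) =
      (ν : Measure (Fin (n + 1) → E)).map fun x i => x i.castSucc := rfl

theorem integral_initLaw {n : ℕ} (ν : ProbabilityMeasure (Fin (n + 1) → E)) {h : (Fin n → E) → ℝ}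
    (hm : Measurable h) :
    ∫ p, h p ∂(initLaw ν : Measure (Fin n → E)) =
      ∫ x, h (fun i => x i.castSucc) ∂(ν : Measure (Fin (n + 1) → E)) := by
  rw [coe_initLaw, integral_map measurable_init.aemeasurable hm.aestronglyMeasurable]

theorem measurable_integral_lastSection {n : ℕ} (κ : Kernel (Fin n → E) E) [IsSFiniteKernel κ]
    {g : (Fin (n + 1) → E) → ℝ} (hg : Measurable g) :
    Measurable fun p => ∫ z, lastSection g p z ∂(κ p) :=
  ((hg.comp measurable_snoc).stronglyMeasurable.integral_kernel_prod_right' (κ := κ)).measurable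

variable [StandardBorelSpace E] [Nonempty E]

/-- `condDistrib` is built from the joint law of the coordinates involved, and this law is the same
under `ν` and `initLaw ν`; hence equality holds for every `p`, not only almost everywhere. -/
theorem disint_castSucc {n : ℕ} (ν : ProbabilityMeasure (Fin (n + 1) → E)) (k : Fin n)
    (p : Fin k → E) : disint ν k.castSucc p = disint (initLaw ν) k p := by
  apply Subtype.ext
  change condDistrib _ _ _ p = condDistrib _ _ _ p
  rw [condDistrib_def, condDistrib_def]
  congr 2
  rw [coe_initLaw, Measure.map_map
    ((measurable_firstCoords k.isLt.le).prodMk (measurable_pi_apply k)) measurable_init]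
  rfl

/-- The last disintegration kernel. -/
noncomputable def lastKernel {n : ℕ} (ν : ProbabilityMeasure (Fin (n + 1) → E)) :
    Kernel (Fin n → E) E :=
  condDistrib (fun x : Fin (n + 1) → E => x (Fin.last n)) (fun x i => x (Fin.castSucc i))
    (ν : Measure (Fin (n + 1) → E))

instance {n : ℕ} (ν : ProbabilityMeasure (Fin (n + 1) → E)) : IsMarkovKernel (lastKernel ν) := by
  unfold lastKernel; infer_instance

theorem initLaw_compProd_lastKernel {n : ℕ} (ν : ProbabilityMeasure (Fin (n + 1) → E)) :
    (initLaw ν : Measure (Fin n → E)) ⊗ₘ lastKernel ν =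
      (ν : Measure (Fin (n + 1) → E)).map fun x => (fun i : Fin n => x i.castSucc, x (Fin.last n)) :=
  compProd_map_condDistrib (measurable_pi_apply _).aemeasurable

theorem integral_eq_integral_lastKernel {n : ℕ} (ν : ProbabilityMeasure (Fin (n + 1) → E))
    {g : (Fin (n + 1) → E) → ℝ} (hg : Measurable g) {C : ℝ} (hC : ∀ x, |g x| ≤ C) :
    ∫ x, g x ∂(ν : Measure (Fin (n + 1) → E)) =
      ∫ p, ∫ z, lastSection g p z ∂(lastKernel ν p) ∂(initLaw ν : Measure (Fin n → E)) := by
  have hm : Measurable fun q : (Fin n → E) × E => g (Fin.snoc (α := fun _ => E) q.1 q.2) :=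
    hg.comp measurable_snoc
  rw [← Measure.integral_compProd (f := fun q : (Fin n → E) × E =>
    g (Fin.snoc (α := fun _ => E) q.1 q.2)) (integrable_of_abs_le hm fun q => hC _),
    initLaw_compProd_lastKernel, integral_map
      (measurable_init.prodMk (measurable_pi_apply _)).aemeasurable hm.aestronglyMeasurable]
  simp only [snoc_init_last]

theorem sum_disint_succ (α : ProbabilityMeasure E → EReal) {n : ℕ}
    (ν : ProbabilityMeasure (Fin (n + 1) → E)) (x : Fin (n + 1) → E) :
    ∑ k : Fin (n + 1), α (disint ν k (firstCoords (k : ℕ) k.isLt.le x)) =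
      ∑ k : Fin n, α (disint (initLaw ν) k (firstCoords (k : ℕ) k.isLt.le fun i => x i.castSucc)) +
        α (disint ν (Fin.last n) fun i => x i.castSucc) := by
  rw [Fin.sum_univ_castSucc]
  congr 1
  exact Finset.sum_congr rfl fun k _ => congrArg α (disint_castSucc ν k _)

end

/-! ### Weak duality -/

section

variable {E : Type*} [TopologicalSpace E] [PolishSpace E] [MeasurableSpace E] [BorelSpace E]
  [Nonempty E] {α : ProbabilityMeasure E → EReal}

/-- Neither `f` (which may be a `condRho`) nor the sum of penalties is known to be measurable. The
induction therefore carries a measurable majorant `F` of the former and a measurable minorant `ψ` of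
the latter. -/
theorem IsDominated.exists_integral_le (hα : IsCompactPenalty α) {n : ℕ} {f : (Fin n → E) → ℝ}
    {y C : ℝ} (hC : ∀ x, |f x| ≤ C) (h : IsDominated α n f y)
    (ν : ProbabilityMeasure (Fin n → E)) :
    ∃ F ψ : (Fin n → E) → ℝ, Measurable F ∧ Measurable ψ ∧ (∃ D, ∀ x, |F x| ≤ D) ∧
      (∃ D, ∀ x, |ψ x| ≤ D) ∧ (∀ x, f x ≤ F x) ∧
      (∀ x, (ψ x : EReal) ≤ ∑ k : Fin n, α (disint ν k (firstCoords (k : ℕ) k.isLt.le x))) ∧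
      ∫ x, F x ∂(ν : Measure (Fin n → E)) ≤ y + ∫ x, ψ x ∂(ν : Measure (Fin n → E)) := by
  induction n generalizing C with
  | zero =>
    refine ⟨f, fun _ => 0, Subsingleton.measurable, measurable_const, ⟨C, hC⟩,
      ⟨0, by simp⟩, fun _ => le_rfl, by simp, ?_⟩
    have : ∫ x, f x ∂(ν : Measure (Fin 0 → E)) = f default := by
      rw [show f = fun _ => f default from funext fun x => congrArg f (Subsingleton.elim _ _)]
      simp
    rw [this]
    simpa using h default
  | succ n ih =>
    obtain ⟨g, hgm, ⟨D, hgD⟩, hfg, hD⟩ := h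
    obtain ⟨F, ψ, hFm, hψm, ⟨DF, hDF⟩, ⟨Dψ, hDψ⟩, hFle, hψle, hint⟩ :=
      ih (hα.abs_condRho_le hgm hgD) hD (initLaw ν)
    set I : (Fin n → E) → ℝ := fun p => ∫ z, lastSection g p z ∂(lastKernel ν p) with hI
    have hIm : Measurable I := measurable_integral_lastSection (lastKernel ν) hgm
    have hID : ∀ p, |I p| ≤ D := fun p => abs_integral_le_of_abs_le fun _ => hgD _
    have hψ' : Measurable fun p => ψ p + (I p - F p) := hψm.add (hIm.sub hFm)
    -- Since `F ≥ condRho α g`, the difference `I - F` is at most the penalty of the last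
    -- conditional law. The integrals of `F` cancel when the two steps are added.
    refine ⟨g, fun x => ψ (fun i => x i.castSucc) +
      (I (fun i => x i.castSucc) - F (fun i => x i.castSucc)), hgm,
      hψ'.comp measurable_init, ⟨D, hgD⟩, ⟨Dψ + (D + DF), fun x => ?_⟩, hfg, fun x => ?_, ?_⟩
    · exact (abs_add_le _ _).trans (add_le_add (hDψ _) ((abs_sub _ _).trans
        (add_le_add (hID _) (hDF _))))
    · rw [sum_disint_succ, EReal.coe_add]
      refine add_le_add (hψle _) ?_
      refine le_trans (EReal.coe_le_coe_iff.2 (sub_le_sub_left (hFle _) _)) ?_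
      exact hα.integral_sub_rho_le (fun _ => hgD _) (disint ν (Fin.last n) fun i => x i.castSucc)
    · rw [integral_eq_integral_lastKernel ν hgm hgD,
        ← integral_initLaw ν hψ', integral_add (g := fun p => I p - F p)
          (integrable_of_abs_le hψm hDψ)
          ((integrable_of_abs_le hIm hID).sub (integrable_of_abs_le hFm hDF)),
        integral_sub (integrable_of_abs_le hIm hID) (integrable_of_abs_le hFm hDF)]
      linarith

theorem IsDominated.integral_sub_le_alphaN (hα : IsCompactPenalty α) {n : ℕ} {f : (Fin n → E) → ℝ}
    {y C : ℝ} (hf : Measurable f) (hC : ∀ x, |f x| ≤ C) (h : IsDominated α n f y)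
    (ν : ProbabilityMeasure (Fin n → E)) :
    ((∫ x, f x ∂(ν : Measure (Fin n → E)) - y : ℝ) : EReal) ≤ alphaN α n ν := by
  obtain ⟨F, ψ, hFm, hψm, ⟨DF, hDF⟩, ⟨Dψ, hDψ⟩, hFle, hψle, hint⟩ := h.exists_integral_le hα hC ν
  refine le_trans (EReal.coe_le_coe_iff.2 ?_)
    ((extIntegral_coe (integrable_of_abs_le hψm hDψ)).symm.le.trans (extIntegral_mono hψle))
  have : ∫ x, f x ∂(ν : Measure (Fin n → E)) ≤ ∫ x, F x ∂(ν : Measure (Fin n → E)) :=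
    integral_mono (integrable_of_abs_le hf hC) (integrable_of_abs_le hFm hDF) hFle
  linarith

theorem IsDominated.rhoN_le (hα : IsCompactPenalty α) {n : ℕ} {f : (Fin n → E) → ℝ}
    {y C : ℝ} (hf : Measurable f) (hC : ∀ x, |f x| ≤ C) (h : IsDominated α n f y) :
    rhoN α n f ≤ (y : EReal) := by
  refine iSup_le fun ν => ?_
  have := h.integral_sub_le_alphaN hα hf hC ν
  refine EReal.sub_le_of_le_add ?_
  have h2 := add_le_add_right this (y : EReal)
  rwa [← EReal.coe_add, add_sub_cancel] at h2

end

/-! ### Measurable selection from compact-valued maps -/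

section selection

variable {X Z : Type*}

/-- The minimizers of `ψ` on `A`. -/
def minimizers (ψ : Z → ℝ) (A : Set Z) : Set Z := {z | z ∈ A ∧ ∀ z' ∈ A, ψ z ≤ ψ z'}

theorem minimizers_subset (ψ : Z → ℝ) (A : Set Z) : minimizers ψ A ⊆ A := fun _ h => h.1

variable [MeasurableSpace X] [TopologicalSpace Z]

/-- A measurable set-valued map with nonempty compact values. -/
structure IsMeasurableCompactValued (M : X → Set Z) : Prop where
  isCompact : ∀ x, IsCompact (M x)
  nonempty : ∀ x, (M x).Nonempty
  measurableSet : ∀ C : Set Z, IsClosed C → MeasurableSet {x | (M x ∩ C).Nonempty}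

theorem IsMeasurableCompactValued.minimizers {M : X → Set Z} (hM : IsMeasurableCompactValued M)
    {ψ : Z → ℝ} (hψ : Continuous ψ) : IsMeasurableCompactValued fun x => minimizers ψ (M x) := by
  have hmin : ∀ x, ∃ z ∈ M x, ∀ z' ∈ M x, ψ z ≤ ψ z' := fun x =>
    (hM.isCompact x).exists_isMinOn (hM.nonempty x) hψ.continuousOn
  refine ⟨fun x => ?_, fun x => ?_, fun C hC => ?_⟩
  · obtain ⟨z, hz, hzmin⟩ := hmin x
    have : _root_.minimizers ψ (M x) = M x ∩ {z' | ψ z' ≤ ψ z} := by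
      ext z'
      exact ⟨fun h => ⟨h.1, h.2 z hz⟩, fun h => ⟨h.1, fun z'' hz'' => h.2.trans (hzmin z'' hz'')⟩⟩
    rw [this]
    exact (hM.isCompact x).inter_right (isClosed_le hψ continuous_const)
  · obtain ⟨z, hz⟩ := hmin x
    exact ⟨z, hz⟩
  -- A minimizer lies in `C` iff the minimum over `M x ∩ C` does not exceed that over `M x`.
  -- Rational levels `q` test this: whenever `M x` meets `{ψ ≤ q}`, so does `M x ∩ C`.
  · have heq : {x | (_root_.minimizers ψ (M x) ∩ C).Nonempty} =
        ⋂ q : ℚ, ({x | (M x ∩ {z | ψ z ≤ q}).Nonempty}ᶜ ∪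
          {x | (M x ∩ (C ∩ {z | ψ z ≤ q})).Nonempty}) := by
      ext x
      simp only [Set.mem_iInter, Set.mem_union]
      constructor
      · rintro ⟨z, ⟨hz, hzmin⟩, hzC⟩ q
        by_cases h : (M x ∩ {z | ψ z ≤ q}).Nonempty
        · obtain ⟨z', hz', hzq⟩ := h
          exact Or.inr ⟨z, hz, hzC, (hzmin z' hz').trans hzq⟩
        · exact Or.inl h
      · intro h
        obtain ⟨z₀, hz₀, hz₀min⟩ := hmin x
        have h' : ∀ q : ℚ, ψ z₀ ≤ q → (M x ∩ (C ∩ {z | ψ z ≤ q})).Nonempty := fun q hq =>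
          (h q).resolve_left (not_not.2 ⟨z₀, hz₀, hq⟩)
        obtain ⟨q₀, hq₀⟩ := exists_rat_gt (ψ z₀)
        obtain ⟨z₁, hz₁, hz₁C, -⟩ := h' q₀ hq₀.le
        obtain ⟨z, ⟨hz, hzC⟩, hzmin⟩ := ((hM.isCompact x).inter_right hC).exists_isMinOn
          ⟨z₁, hz₁, hz₁C⟩ hψ.continuousOn
        have hle : ψ z ≤ ψ z₀ := by
          refine le_of_forall_gt_imp_ge_of_dense fun b hb => ?_
          obtain ⟨q, hq1, hq2⟩ := exists_rat_btwn hb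
          obtain ⟨z₂, hz₂, hz₂C, hz₂q⟩ := h' q hq1.le
          exact (hzmin ⟨hz₂, hz₂C⟩ : ψ z ≤ ψ z₂).trans (le_trans hz₂q hq2.le)
        exact ⟨z, ⟨hz, fun z' hz' => hle.trans (hz₀min z' hz')⟩, hzC⟩
    rw [heq]
    refine MeasurableSet.iInter fun q => ?_
    have hq : IsClosed {z | ψ z ≤ q} := isClosed_le hψ continuous_const
    exact (hM.measurableSet _ hq).compl.union (hM.measurableSet _ (hC.inter hq))

/-- A measurable set-valued map with nonempty compact values has a measurable selection. -/
theorem IsMeasurableCompactValued.exists_selection [T2Space Z] {M : X → Set Z}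
    (hM : IsMeasurableCompactValued M) {ψ : ℕ → Z → ℝ} (hψ : ∀ i, Continuous (ψ i))
    (hsep : ∀ x, ∀ z ∈ M x, ∀ z' ∈ M x, (∀ i, ψ i z = ψ i z') → z = z') :
    ∃ s : X → Z, (∀ x, s x ∈ M x) ∧ ∀ C, IsClosed C → MeasurableSet (s ⁻¹' C) := by
  -- Minimizing `ψ 0`, `ψ 1`, … in turn shrinks `M x` to a single point, because the `ψ i` separate
  -- points. By compactness this point lies in `C` iff every stage meets `C`.
  let N : ℕ → X → Set Z := fun i => Nat.rec M (fun i A x => _root_.minimizers (ψ i) (A x)) i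
  have hN : ∀ i, IsMeasurableCompactValued (N i) := fun i => by
    induction i with
    | zero => exact hM
    | succ i ih => exact ih.minimizers (hψ i)
  have hsucc : ∀ i x, N (i + 1) x = _root_.minimizers (ψ i) (N i x) := fun _ _ => rfl
  have hinter : ∀ x C, IsClosed C → (∀ i, (N i x ∩ C).Nonempty) → (⋂ i, N i x ∩ C).Nonempty :=
    fun x C hC hne => IsCompact.nonempty_iInter_of_sequence_nonempty_isCompact_isClosed _
      (fun i => Set.inter_subset_inter_left _ (minimizers_subset _ _)) hne
      (((hN 0).isCompact x).inter_right hC) fun i => ((hN i).isCompact x).isClosed.inter hC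
  have hs : ∀ x, ∃ z, ∀ i, z ∈ N i x := fun x => by
    obtain ⟨z, hz⟩ := hinter x Set.univ isClosed_univ fun i => by
      simpa using (hN i).nonempty x
    exact ⟨z, fun i => (Set.mem_iInter.1 hz i).1⟩
  choose s hs using hs
  refine ⟨s, fun x => hs x 0, fun C hC => ?_⟩
  have heq : s ⁻¹' C = ⋂ i, {x | (N i x ∩ C).Nonempty} := by
    ext x
    rw [Set.mem_iInter]
    refine ⟨fun h i => ⟨s x, hs x i, h⟩, fun h => ?_⟩
    obtain ⟨z, hz⟩ := hinter x C hC h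
    have hz' : ∀ i, z ∈ N i x := fun i => (Set.mem_iInter.1 hz i).1
    have : z = s x := hsep x z (hz' 0) (s x) (hs x 0) fun i => by
      have h1 := hz' (i + 1)
      have h2 := hs x (i + 1)
      rw [hsucc] at h1 h2
      exact le_antisymm (h1.2 _ h2.1) (h2.2 _ h1.1)
    rw [Set.mem_preimage, ← this]
    exact (Set.mem_iInter.1 hz 0).2
  rw [heq]
  exact MeasurableSet.iInter fun i => (hN i).measurableSet C hC

/-- The distances to the points of a countable set whose closure contains `K` determine a point of
`K`. -/
theorem IsCompact.exists_continuous_separating [TopologicalSpace.MetrizableSpace Z] {K : Set Z}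
    (hK : IsCompact K) : ∃ ψ : ℕ → Z → ℝ, (∀ i, Continuous (ψ i)) ∧
      ∀ z ∈ K, ∀ z' ∈ K, (∀ i, ψ i z = ψ i z') → z = z' := by
  let _ := TopologicalSpace.metrizableSpaceMetric Z
  rcases K.eq_empty_or_nonempty with rfl | ⟨z₀, hz₀⟩
  · exact ⟨fun _ _ => 0, fun _ => continuous_const, by simp⟩
  obtain ⟨c, hc, hKc⟩ := hK.isSeparable
  have hcne : c.Nonempty := closure_nonempty_iff.1 ⟨z₀, hKc hz₀⟩
  obtain ⟨d, hd⟩ := hc.exists_eq_range hcne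
  refine ⟨fun i z => dist z (d i), fun i => continuous_id.dist continuous_const,
    fun z hz z' _ h => dist_le_zero.1 (le_of_forall_pos_le_add fun ε hε => ?_)⟩
  obtain ⟨b, hb, hzb⟩ := Metric.mem_closure_iff.1 (hKc hz) (ε / 2) (half_pos hε)
  rw [hd] at hb
  obtain ⟨i, rfl⟩ := hb
  have := dist_triangle_right z z' (d i)
  have h2 := h i
  simp only at h2
  linarith

end selection

/-- A family of probability measures that is measurable for the weak topology is a kernel. -/
theorem measurable_of_isClosed_preimage {X E : Type*} [MeasurableSpace X] [TopologicalSpace E]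
    [MeasurableSpace E] [BorelSpace E] [HasOuterApproxClosed E] {s : X → ProbabilityMeasure E}
    (hs : ∀ C, IsClosed C → MeasurableSet (s ⁻¹' C)) :
    Measurable fun x => (s x : Measure E) := by
  refine Measurable.measure_of_isPiSystem_of_isProbabilityMeasure (S := {F : Set E | IsClosed F})
    (BorelSpace.measurable_eq.trans borel_eq_generateFrom_isClosed) isPiSystem_isClosed fun F hF => ?_
  refine measurable_of_Ici fun r => ?_
  refine hs {ν : ProbabilityMeasure E | r ≤ (ν : Measure E) F} ?_
  -- By the portmanteau theorem, `ν ↦ ν F` is upper semicontinuous for closed `F`.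
  refine isClosed_of_closure_subset fun ν hν => ?_
  obtain ⟨L, hL, hLν⟩ := mem_closure_iff_ultrafilter.1 hν
  have ht : Tendsto id (L : Filter (ProbabilityMeasure E)) (𝓝 ν) := hLν
  refine le_trans ?_ (ProbabilityMeasure.limsup_measure_closed_le_of_tendsto ht hF)
  exact le_limsup_of_frequently_le (Eventually.frequently hL) (by isBoundedDefault)

/-! ### Optimal laws for decreasing limits of Lipschitz functions -/

/-- `u` is the decreasing limit of the Lipschitz functions `c j`, which are bounded by `C`. -/
structure IsLipschitzApprox {X : Type*} [PseudoMetricSpace X] (C : ℝ) (c : ℕ → X → ℝ) (u : X → ℝ) :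
    Prop where
  lipschitz : ∀ j, ∃ K : ℝ≥0, LipschitzWith K (c j)
  abs_le : ∀ j x, |c j x| ≤ C
  antitone : ∀ x, Antitone fun j => c j x
  tendsto : ∀ x, Tendsto (fun j => c j x) atTop (𝓝 (u x))

namespace IsLipschitzApprox

variable {X : Type*} [PseudoMetricSpace X] {C : ℝ} {c : ℕ → X → ℝ} {u : X → ℝ}

theorem continuous (h : IsLipschitzApprox C c u) (j : ℕ) : Continuous (c j) :=
  (h.lipschitz j).choose_spec.continuous

theorem measurable [MeasurableSpace X] [OpensMeasurableSpace X] (h : IsLipschitzApprox C c u) :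
    Measurable u :=
  measurable_of_tendsto_metrizable (fun j => (h.continuous j).measurable) (tendsto_pi_nhds.2 h.tendsto)

theorem abs_limit_le (h : IsLipschitzApprox C c u) (x : X) : |u x| ≤ C :=
  le_of_tendsto ((h.tendsto x).abs) (Eventually.of_forall fun j => h.abs_le j x)

theorem limit_le (h : IsLipschitzApprox C c u) (j : ℕ) (x : X) : u x ≤ c j x :=
  (h.antitone x).le_of_tendsto (h.tendsto x) j

end IsLipschitzApprox

/-- The conjugate of `α`, applied successively in all the variables, starting with the last one. -/
noncomputable def iterRho {E : Type*} [MeasurableSpace E] (α : ProbabilityMeasure E → EReal) :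
    (n : ℕ) → ((Fin n → E) → ℝ) → ℝ
  | 0, f => f Fin.elim0
  | n + 1, f => iterRho α n (condRho α f)

section

variable {E : Type*} [MetricSpace E]

theorem dist_snoc_snoc_le {n : ℕ} (p p' : Fin n → E) (z : E) :
    dist (Fin.snoc (α := fun _ => E) p z : Fin (n + 1) → E) (Fin.snoc (α := fun _ => E) p' z) ≤
      dist p p' := by
  refine (dist_pi_le_iff dist_nonneg).2 fun i => ?_
  induction i using Fin.lastCases with
  | last => simp
  | cast i => simpa using dist_le_pi_dist p p' i

theorem continuous_lastSection {n : ℕ} {g : (Fin (n + 1) → E) → ℝ} (hg : Continuous g)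
    (p : Fin n → E) : Continuous (lastSection g p) :=
  hg.comp (continuous_const.finSnoc continuous_id)

variable [MeasurableSpace E] [BorelSpace E] {α : ProbabilityMeasure E → EReal}

/-- `ρ` is monotone and satisfies `ρ(w + δ) ≤ ρ(w) + δ`, so it is nonexpansive for the sup norm. -/
theorem lipschitzWith_condRho (hα : IsCompactPenalty α) {n : ℕ} {g : (Fin (n + 1) → E) → ℝ} {C : ℝ}
    {K : ℝ≥0} (hg : LipschitzWith K g) (hC : ∀ x, |g x| ≤ C) : LipschitzWith K (condRho α g) :=
  LipschitzWith.of_le_add_mul K fun p p' =>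
    hα.rho_le_add (fun _ => hC _) (fun _ => hC _)
      (continuous_lastSection hg.continuous p).measurable
      (continuous_lastSection hg.continuous p').measurable fun z =>
        (hg.le_add_mul _ _).trans (add_le_add_right
          (mul_le_mul_of_nonneg_left (dist_snoc_snoc_le p p' z) K.2) _)

theorem IsLipschitzApprox.attained_and_tendsto_condRho (hα : IsCompactPenalty α) {n : ℕ} {C : ℝ}
    {c : ℕ → (Fin (n + 1) → E) → ℝ} {u : (Fin (n + 1) → E) → ℝ} (h : IsLipschitzApprox C c u)
    (p : Fin n → E) :
    (∃ ν : ProbabilityMeasure E,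
      α ν = ((∫ z, lastSection u p z ∂(ν : Measure E) - condRho α u p : ℝ) : EReal)) ∧
      Tendsto (fun j => condRho α (c j) p) atTop (𝓝 (condRho α u p)) :=
  hα.exists_eq_and_tendsto_rho (fun j => continuous_lastSection (h.continuous j) p)
    (fun j _ => h.abs_le j _) (fun _ => h.antitone _) (fun _ => h.tendsto _)

variable [PolishSpace E]

theorem isDominated_iterRho (hα : IsCompactPenalty α) {n : ℕ} {f : (Fin n → E) → ℝ} {C : ℝ}
    {K : ℝ≥0} (hf : LipschitzWith K f) (hC : ∀ x, |f x| ≤ C) :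
    IsDominated α n f (iterRho α n f) := by
  induction n generalizing C with
  | zero => exact fun x => (congrArg f (Subsingleton.elim _ _)).le
  | succ n ih =>
    exact ⟨f, hf.continuous.measurable, ⟨C, hC⟩, fun _ => le_rfl,
      ih (lipschitzWith_condRho hα hf hC) (hα.abs_condRho_le hf.continuous.measurable hC)⟩

namespace IsLipschitzApprox

/-- Thus every stage of the backward iteration stays in the class, and in particular stays Borel. -/
theorem condRho (hα : IsCompactPenalty α) {n : ℕ} {C : ℝ}
    {c : ℕ → (Fin (n + 1) → E) → ℝ} {u : (Fin (n + 1) → E) → ℝ} (h : IsLipschitzApprox C c u) :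
    IsLipschitzApprox (C + |rho α (fun _ => 0)|) (fun j => condRho α (c j)) (condRho α u) where
  lipschitz j := by
    obtain ⟨K, hK⟩ := h.lipschitz j
    exact ⟨K, lipschitzWith_condRho hα hK (h.abs_le j)⟩
  abs_le j := hα.abs_condRho_le (h.continuous j).measurable (h.abs_le j)
  antitone p i j hij := hα.rho_mono (fun _ => h.abs_le j _) (fun _ => h.abs_le i _)
    (continuous_lastSection (h.continuous j) p).measurable
    (continuous_lastSection (h.continuous i) p).measurable fun _ => h.antitone _ hij
  tendsto p := (h.attained_and_tendsto_condRho hα p).2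

theorem tendsto_iterRho (hα : IsCompactPenalty α) {n : ℕ} {C : ℝ} {c : ℕ → (Fin n → E) → ℝ}
    {u : (Fin n → E) → ℝ} (h : IsLipschitzApprox C c u) :
    Tendsto (fun j => iterRho α n (c j)) atTop (𝓝 (iterRho α n u)) := by
  induction n generalizing C with
  | zero => exact h.tendsto _
  | succ n ih => exact ih (h.condRho hα)

/-- Let `β` be `α` on `F` and `⊤` elsewhere; it is in general not convex, but again an
`IsCompactPenalty`. Its supremum is attained in `F`, so `F` contains a maximizer for `α` iff
`condRho α u p ≤ condRho β u p`, and both sides are measurable in `p`. -/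
theorem measurableSet_maximizers_inter (hα : IsCompactPenalty α) {n : ℕ} {C : ℝ}
    {c : ℕ → (Fin (n + 1) → E) → ℝ} {u : (Fin (n + 1) → E) → ℝ} (h : IsLipschitzApprox C c u)
    {F : Set (ProbabilityMeasure E)} (hF : IsClosed F) :
    MeasurableSet {p : Fin n → E | ({ν : ProbabilityMeasure E |
      α ν ≤ ((∫ z, lastSection u p z ∂(ν : Measure E) - _root_.condRho α u p : ℝ) : EReal)} ∩
        F).Nonempty} := by
  classical
  -- If `α = ⊤` on `F`, then `β` is not proper, but no maximizer lies in `F`.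
  by_cases hprop : ∃ ν ∈ F, α ν ≠ ⊤
  swap
  · convert MeasurableSet.empty
    refine Set.eq_empty_of_forall_notMem fun p => ?_
    rintro ⟨ν, hν, hνF⟩
    exact hprop ⟨ν, hνF, ne_top_of_le_ne_top (EReal.coe_ne_top _) hν⟩
  set β : ProbabilityMeasure E → EReal := fun ν => if ν ∈ F then α ν else ⊤ with hβdef
  have hβF : ∀ ν ∈ F, β ν = α ν := fun ν hν => if_pos hν
  have hβ : IsCompactPenalty β := by
    refine ⟨fun ν => ?_, ?_, fun r => ?_⟩
    · by_cases hν : ν ∈ F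
      · rw [hβF ν hν]; exact hα.ne_bot ν
      · simp [hβdef, hν]
    · obtain ⟨ν, hν, hν'⟩ := hprop
      exact ⟨ν, by rwa [hβF ν hν]⟩
    · have : {ν | β ν ≤ (r : EReal)} = {ν | α ν ≤ (r : EReal)} ∩ F := by
        ext ν
        by_cases hν : ν ∈ F <;> simp [hβdef, hν]
      rw [this]
      exact (hα.isCompact_sublevel r).inter_right hF
  have heq : {p : Fin n → E | ({ν : ProbabilityMeasure E |
      α ν ≤ ((∫ z, lastSection u p z ∂(ν : Measure E) - _root_.condRho α u p : ℝ) : EReal)} ∩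
        F).Nonempty} = {p | _root_.condRho α u p ≤ _root_.condRho β u p} := by
    ext p
    constructor
    · rintro ⟨ν, hν, hνF⟩
      have h1 := hβ.integral_sub_rho_le (w := lastSection u p) (fun _ => h.abs_limit_le _) ν
      rw [hβF ν hνF] at h1
      have h2 := EReal.coe_le_coe_iff.1 (h1.trans hν)
      exact (sub_le_sub_iff_left _).1 h2
    · intro hp
      obtain ⟨ν, hν⟩ := (h.attained_and_tendsto_condRho hβ p).1
      have hνF : ν ∈ F := by
        by_contra hνF
        simp only [hβdef, hνF, if_false] at hν
        exact EReal.coe_ne_top _ hν.symm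
      refine ⟨ν, ?_, hνF⟩
      rw [hβF ν hνF] at hν
      exact hν.le.trans (EReal.coe_le_coe_iff.2 (sub_le_sub_left hp _))
  rw [heq]
  exact measurableSet_le (h.condRho hα).measurable (h.condRho hβ).measurable

/-- The maximizers in the definition of `condRho α u` can be chosen measurably. -/
theorem exists_kernel (hα : IsCompactPenalty α) {n : ℕ} {C : ℝ}
    {c : ℕ → (Fin (n + 1) → E) → ℝ} {u : (Fin (n + 1) → E) → ℝ} (h : IsLipschitzApprox C c u) :
    ∃ s : (Fin n → E) → ProbabilityMeasure E, Measurable (fun p => (s p : Measure E)) ∧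
      ∀ p, α (s p) =
        ((∫ z, lastSection u p z ∂(s p : Measure E) - _root_.condRho α u p : ℝ) : EReal) := by
  set M : (Fin n → E) → Set (ProbabilityMeasure E) := fun p => {ν : ProbabilityMeasure E |
    α ν ≤ ((∫ z, lastSection u p z ∂(ν : Measure E) - _root_.condRho α u p : ℝ) : EReal)} with hM
  have hcompact : ∀ p, IsCompact (M p) := fun p => by
    -- The integral of `u` is only upper semicontinuous in `ν`; the continuous `c j` give an
    -- intersection of compact sets.
    have : M p = ⋂ j, {ν : ProbabilityMeasure E |
        α ν ≤ ((∫ z, lastSection (c j) p z ∂(ν : Measure E) -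
          _root_.condRho α u p : ℝ) : EReal)} := by
      ext ν
      rw [Set.mem_iInter]
      constructor
      · refine fun hν j => le_trans hν (EReal.coe_le_coe_iff.2 (sub_le_sub_right ?_ _))
        exact integral_mono
          (integrable_of_abs_le (measurable_lastSection h.measurable p) fun _ => h.abs_limit_le _)
          (integrable_of_abs_le (measurable_lastSection (h.continuous j).measurable p)
            fun _ => h.abs_le j _) fun _ => h.limit_le j _
      · intro hν
        have ht : Tendsto (fun j => ∫ z, lastSection (c j) p z ∂(ν : Measure E) -
            _root_.condRho α u p) atTop
            (𝓝 (∫ z, lastSection u p z ∂(ν : Measure E) - _root_.condRho α u p)) :=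
          (tendsto_integral_of_dominated_convergence (fun _ => C)
            (fun j => (measurable_lastSection (h.continuous j).measurable p).aestronglyMeasurable)
            (integrable_const _) (fun j => ae_of_all _ fun _ => h.abs_le j _)
            (ae_of_all _ fun _ => h.tendsto _)).sub_const _
        exact ge_of_tendsto' ((continuous_coe_real_ereal.tendsto _).comp ht) hν
    have hj := fun j => hα.isCompact_setOf_le_integral_sub
      (continuous_lastSection (h.continuous j) p) (fun _ => h.abs_le j _) (_root_.condRho α u p)
    rw [this]
    exact (hj 0).of_isClosed_subset (isClosed_iInter fun j => (hj j).isClosed)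
      (Set.iInter_subset _ 0)
  have hMv : IsMeasurableCompactValued M := by
    refine ⟨hcompact, fun p => ?_, fun F hF => h.measurableSet_maximizers_inter hα hF⟩
    obtain ⟨ν, hν⟩ := (h.attained_and_tendsto_condRho hα p).1
    exact ⟨ν, hν.le⟩
  -- All `M p` lie in one sub-level set, as `|∫ u| ≤ C` and `|condRho α u p| ≤ C + |ρ(0)|`; so one
  -- separating sequence serves every `p`.
  obtain ⟨ψ, hψ, hsep⟩ :=
    (hα.isCompact_sublevel (C + (C + |rho α (fun _ => 0)|))).exists_continuous_separating
  have hMK : ∀ p, ∀ ν ∈ M p, α ν ≤ ((C + (C + |rho α (fun _ => 0)|) : ℝ) : EReal) :=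
    fun p ν hν => le_trans hν (EReal.coe_le_coe_iff.2 (by
      have h1 := (_root_.abs_le.1 (abs_integral_le_of_abs_le (ν := (ν : Measure E))
        (f := lastSection u p) fun _ => h.abs_limit_le _)).2
      have h2 := (_root_.abs_le.1 ((h.condRho hα).abs_limit_le p)).1
      linarith))
  obtain ⟨s, hs, hsm⟩ := hMv.exists_selection hψ fun p ν hν ν' hν' =>
    hsep ν (hMK p ν hν) ν' (hMK p ν' hν')
  exact ⟨s, measurable_of_isClosed_preimage hsm, fun p => le_antisymm (hs p)
    (hα.integral_sub_rho_le (fun _ => h.abs_limit_le _) _)⟩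

variable [Nonempty E]

/-- The optimal law is built forwards: the optimal law for `condRho α u` is extended by the kernel
of maximizers. Disintegrations are unique only almost everywhere, so the sum of penalties is
identified with the bounded `ψ` only up to a null set. -/
theorem exists_integral_eq (hα : IsCompactPenalty α) {n : ℕ} {C : ℝ} {c : ℕ → (Fin n → E) → ℝ}
    {u : (Fin n → E) → ℝ} (h : IsLipschitzApprox C c u) :
    ∃ (ν : ProbabilityMeasure (Fin n → E)) (ψ : (Fin n → E) → ℝ), Measurable ψ ∧
      (∃ D, ∀ x, |ψ x| ≤ D) ∧
      (fun x => ∑ k : Fin n, α (disint ν k (firstCoords (k : ℕ) k.isLt.le x))) =ᵐ[(ν : Measure (Fin n → E))]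
        (fun x => (ψ x : EReal)) ∧
      ∫ x, ψ x ∂(ν : Measure (Fin n → E)) =
        ∫ x, u x ∂(ν : Measure (Fin n → E)) - iterRho α n u := by
  induction n generalizing C with
  | zero =>
    refine ⟨⟨Measure.dirac Fin.elim0, inferInstance⟩, fun _ => 0, measurable_const, ⟨0, by simp⟩,
      by simp, ?_⟩
    simp only [iterRho, ProbabilityMeasure.coe_mk]
    rw [integral_dirac]
    simp
  | succ n ih =>
    obtain ⟨ν', ψ', hψm, ⟨D, hD⟩, hae, hint⟩ := ih (h.condRho hα)
    obtain ⟨s, hsm, hs⟩ := h.exists_kernel hα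
    let κ : Kernel (Fin n → E) E := ⟨fun p => (s p : Measure E), hsm⟩
    have hκ : ∀ p, κ p = (s p : Measure E) := fun _ => rfl
    have : IsMarkovKernel κ := ⟨fun p => by rw [hκ]; infer_instance⟩
    let ν : ProbabilityMeasure (Fin (n + 1) → E) :=
      ⟨((ν' : Measure (Fin n → E)) ⊗ₘ κ).map fun q => Fin.snoc (α := fun _ => E) q.1 q.2,
        Measure.isProbabilityMeasure_map measurable_snoc.aemeasurable⟩
    have hpair : (ν : Measure (Fin (n + 1) → E)).map
        (fun x => (fun i : Fin n => x i.castSucc, x (Fin.last n))) =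
        (ν' : Measure (Fin n → E)) ⊗ₘ κ := by
      change (((ν' : Measure (Fin n → E)) ⊗ₘ κ).map _).map _ = _
      rw [Measure.map_map (measurable_init.prodMk (measurable_pi_apply _)) measurable_snoc]
      convert Measure.map_id
      ext q <;> simp
    have hinit : initLaw ν = ν' := by
      apply Subtype.ext
      change (ν : Measure (Fin (n + 1) → E)).map _ = (ν' : Measure (Fin n → E))
      have := congrArg Measure.fst hpair
      rwa [Measure.fst_compProd, Measure.fst, Measure.map_map measurable_fst
        (measurable_init.prodMk (measurable_pi_apply _))] at this
    have hker : lastKernel ν =ᵐ[(initLaw ν : Measure (Fin n → E))] κ := by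
      refine condDistrib_ae_eq_of_measure_eq_compProd _ (measurable_pi_apply _).aemeasurable ?_
      rw [hpair, ← hinit]
      rfl
    set I : (Fin n → E) → ℝ := fun p => ∫ z, lastSection u p z ∂(κ p) with hI
    have hIm : Measurable I := measurable_integral_lastSection κ h.measurable
    have hIC : ∀ p, |I p| ≤ C := fun p => abs_integral_le_of_abs_le fun _ => h.abs_limit_le _
    have hc := h.condRho hα
    have hψ' : Measurable fun p => ψ' p + (I p - _root_.condRho α u p) :=
      hψm.add (hIm.sub hc.measurable)
    refine ⟨ν, fun x => ψ' (fun i => x i.castSucc) + (I (fun i => x i.castSucc) -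
      _root_.condRho α u (fun i => x i.castSucc)), hψ'.comp measurable_init,
      ⟨D + (C + (C + |rho α (fun _ => 0)|)), fun x => ?_⟩, ?_, ?_⟩
    · exact (abs_add_le _ _).trans (add_le_add (hD _) ((abs_sub _ _).trans
        (add_le_add (hIC _) (hc.abs_limit_le _))))
    · rw [← hinit] at hae
      have h1 := ae_of_ae_map measurable_init.aemeasurable hae
      have h2 := ae_of_ae_map measurable_init.aemeasurable hker
      filter_upwards [h1, h2] with x hx1 hx2
      rw [sum_disint_succ, hx1, EReal.coe_add]
      have : disint ν (Fin.last n) (fun i => x i.castSucc) = s fun i => x i.castSucc :=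
        Subtype.ext (hx2.trans (hκ _))
      rw [this, hs]
      rfl
    · rw [← integral_initLaw ν hψ', integral_eq_integral_lastKernel ν h.measurable h.abs_limit_le,
        integral_add (g := fun p => I p - _root_.condRho α u p) (integrable_of_abs_le hψm hD)
          ((integrable_of_abs_le hIm hIC).sub (integrable_of_abs_le hc.measurable hc.abs_limit_le)),
        integral_sub (integrable_of_abs_le hIm hIC)
          (integrable_of_abs_le hc.measurable hc.abs_limit_le)]
      have h3 : ∫ p, ∫ z, lastSection u p z ∂(lastKernel ν p) ∂(initLaw ν : Measure (Fin n → E)) =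
          ∫ p, I p ∂(initLaw ν : Measure (Fin n → E)) :=
        integral_congr_ae (hker.mono fun p hp => by simp only [hI, hp])
      rw [h3, hinit, hint]
      simp only [iterRho]
      ring

theorem iterRho_le_rhoN (hα : IsCompactPenalty α) {n : ℕ} {C : ℝ} {c : ℕ → (Fin n → E) → ℝ}
    {u : (Fin n → E) → ℝ} (h : IsLipschitzApprox C c u) {f : (Fin n → E) → ℝ} {D : ℝ}
    (hf : Measurable f) (hD : ∀ x, |f x| ≤ D) (hle : ∀ x, u x ≤ f x) :
    (iterRho α n u : EReal) ≤ rhoN α n f := by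
  obtain ⟨ν, ψ, hψm, ⟨B, hB⟩, hae, hint⟩ := h.exists_integral_eq hα
  have halpha : alphaN α n ν = ((∫ x, ψ x ∂(ν : Measure (Fin n → E)) : ℝ) : EReal) := by
    rw [alphaN, extIntegral_congr_ae hae, extIntegral_coe (integrable_of_abs_le hψm hB)]
  refine le_trans ?_ (le_iSup _ ν)
  rw [halpha, ← EReal.coe_sub, EReal.coe_le_coe_iff, hint]
  have : ∫ x, u x ∂(ν : Measure (Fin n → E)) ≤ ∫ x, f x ∂(ν : Measure (Fin n → E)) :=
    integral_mono (integrable_of_abs_le h.measurable h.abs_limit_le) (integrable_of_abs_le hf hD) hle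
  linarith

end IsLipschitzApprox

end

/-! ### Capacitability -/

/-- Choquet's capacitability theorem, for a property `D` of bounded functions that is inherited by
smaller functions and by limits from below: if a bounded Borel function `f` fails `D`, then there is
a decreasing sequence of Lipschitz functions failing `D` whose limit is below `f`. -/
theorem exists_isLipschitzApprox_of_not {X : Type*} [MetricSpace X] [PolishSpace X] [Nonempty X]
    [MeasurableSpace X] [BorelSpace X] {D : (X → ℝ) → Prop} {C : ℝ}
    (hmono : ∀ f g : X → ℝ, D g → (∀ x, f x ≤ g x) → D f)
    (hlim : ∀ (f : ℕ → X → ℝ) (g : X → ℝ), (∀ j x, |f j x| ≤ C) → (∀ j, D (f j)) →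
      (∀ x, g x ≤ liminf (fun j => f j x) atTop) → D g)
    {f : X → ℝ} (hf : Measurable f) (hC : ∀ x, |f x| ≤ C) (hD : ¬D f) :
    ∃ (c : ℕ → X → ℝ) (u : X → ℝ), IsLipschitzApprox C c u ∧ (∀ x, u x ≤ f x) ∧ ∀ j, ¬D (c j) := by
  have hflow : ∀ x, -C ≤ f x := fun x => (abs_le.1 (hC x)).1
  have hfup : ∀ x, f x ≤ C := fun x => (abs_le.1 (hC x)).2
  have hC0 : -C ≤ C := (hflow (Classical.arbitrary X)).trans (hfup _)
  -- parametrize the part of the hypograph above `-C` by the Baire space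
  obtain ⟨ξ, t, hξ, ht, htf, hsurj⟩ : ∃ (ξ : (ℕ → ℕ) → X) (t : (ℕ → ℕ) → ℝ), Continuous ξ ∧
      Continuous t ∧ (∀ a, t a ≤ f (ξ a)) ∧ ∀ x, ∃ a, ξ a = x ∧ t a = f x := by
    have hH : MeasurableSet {q : X × ℝ | -C ≤ q.2 ∧ q.2 ≤ f q.1} :=
      (measurableSet_le measurable_const measurable_snd).inter
        (measurableSet_le measurable_snd (hf.comp measurable_fst))
    have hmem : ∀ x, (x, f x) ∈ {q : X × ℝ | -C ≤ q.2 ∧ q.2 ≤ f q.1} := fun x => ⟨hflow x, le_rfl⟩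
    have han := hH.analyticSet
    rw [AnalyticSet] at han
    rcases han with hempty | ⟨φ, hφ, hrange⟩
    · exact absurd (hmem (Classical.arbitrary X)) (by rw [hempty]; exact Set.notMem_empty _)
    · have hφmem : ∀ a, φ a ∈ {q : X × ℝ | -C ≤ q.2 ∧ q.2 ≤ f q.1} := fun a =>
        hrange ▸ Set.mem_range_self a
      refine ⟨fun a => (φ a).1, fun a => (φ a).2, continuous_fst.comp hφ, continuous_snd.comp hφ,
        fun a => (hφmem a).2, fun x => ?_⟩
      obtain ⟨a, ha⟩ : (x, f x) ∈ Set.range φ := hrange ▸ hmem x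
      exact ⟨a, congrArg Prod.fst ha, congrArg Prod.snd ha⟩
  have htup : ∀ a, t a ≤ C := fun a => (htf a).trans (hfup _)
  -- the upper envelope of the part of the hypograph parametrized by `B`
  set env : Set (ℕ → ℕ) → X → ℝ := fun B x => sSup (insert (-C) {r | ∃ a ∈ B, ξ a = x ∧ t a = r})
  have hbdd : ∀ (B : Set (ℕ → ℕ)) x, BddAbove (insert (-C) {r | ∃ a ∈ B, ξ a = x ∧ t a = r}) := fun B x => by
    refine ⟨C, ?_⟩
    rintro r (rfl | ⟨a, -, -, rfl⟩)
    exacts [hC0, htup a]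
  have henvC : ∀ (B : Set (ℕ → ℕ)) x, |env B x| ≤ C := fun B x => by
    refine abs_le.2 ⟨le_csSup (hbdd B x) (Set.mem_insert _ _), csSup_le (Set.insert_nonempty _ _) ?_⟩
    rintro r (rfl | ⟨a, -, -, rfl⟩)
    exacts [hC0, htup a]
  -- As `m` grows, the sets `B ∩ {a k ≤ m}` exhaust `B`, so if all their envelopes had `D`, the
  -- limit property would give `D (env B)`.
  have hstep : ∀ (B : {B : Set (ℕ → ℕ) // ¬D (env B)}) (k : ℕ),
      ∃ m : ℕ, ¬D (env (B.1 ∩ {a | a k ≤ m})) := by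
    rintro ⟨B, hB⟩ k
    by_contra! hcon
    refine hB (hlim _ _ (fun m => henvC _) hcon fun x => csSup_le (Set.insert_nonempty _ _) ?_)
    have hcob : IsCoboundedUnder (· ≥ ·) atTop fun m : ℕ => env (B ∩ {a | a k ≤ m}) x :=
      (isBoundedUnder_of ⟨C, fun m => (abs_le.1 (henvC _ x)).2⟩).isCoboundedUnder_ge
    rintro r (rfl | ⟨a, haB, hax, rfl⟩)
    · exact le_liminf_of_le hcob (Eventually.of_forall fun m => (abs_le.1 (henvC _ x)).1)
    · exact le_liminf_of_le hcob ((eventually_ge_atTop (a k)).mono fun m hm =>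
        le_csSup (hbdd _ x) (Or.inr ⟨a, ⟨haB, hm⟩, hax, rfl⟩))
  choose m hm using hstep
  have huniv : ¬D (env Set.univ) := fun h => hD (hmono _ _ h fun x => by
    obtain ⟨a, ha, hta⟩ := hsurj x
    exact le_csSup (hbdd _ x) (Or.inr ⟨a, trivial, ha, hta⟩))
  let S : ℕ → {B : Set (ℕ → ℕ) // ¬D (env B)} := fun k =>
    Nat.rec ⟨Set.univ, huniv⟩ (fun k B => ⟨B.1 ∩ {a | a k ≤ m B k}, hm B k⟩) k
  have hSsucc : ∀ k, (S (k + 1)).1 = (S k).1 ∩ {a | a k ≤ m (S k) k} := fun _ => rfl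
  have hSanti : Antitone fun k => (S k).1 :=
    antitone_nat_of_succ_le fun k => by rw [hSsucc]; exact Set.inter_subset_left
  -- Lipschitz envelopes
  set c : ℕ → X → ℝ := fun k x =>
    sSup (insert (-C) {r | ∃ a ∈ (S k).1, t a - k * dist x (ξ a) = r})
  have hcbdd : ∀ k x, BddAbove (insert (-C) {r | ∃ a ∈ (S k).1, t a - k * dist x (ξ a) = r}) :=
    fun k x => by
      refine ⟨C, ?_⟩
      rintro r (rfl | ⟨a, -, rfl⟩)
      · exact hC0
      · linarith [htup a, mul_nonneg k.cast_nonneg (dist_nonneg (x := x) (y := ξ a)) (α := ℝ)]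
  have hcge : ∀ k x, ∀ a ∈ (S k).1, t a - k * dist x (ξ a) ≤ c k x := fun k x a ha =>
    le_csSup (hcbdd k x) (Or.inr ⟨a, ha, rfl⟩)
  have hclow : ∀ k x, -C ≤ c k x := fun k x => le_csSup (hcbdd k x) (Set.mem_insert _ _)
  have hcle : ∀ k x b, -C ≤ b → (∀ a ∈ (S k).1, t a - k * dist x (ξ a) ≤ b) → c k x ≤ b := by
    intro k x b hb h
    refine csSup_le (Set.insert_nonempty _ _) ?_
    rintro r (rfl | ⟨a, ha, rfl⟩)
    exacts [hb, h a ha]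
  have hcC : ∀ k x, |c k x| ≤ C := fun k x => abs_le.2 ⟨hclow k x, hcle k x C hC0 fun a _ => by
    linarith [htup a, mul_nonneg k.cast_nonneg (dist_nonneg (x := x) (y := ξ a)) (α := ℝ)]⟩
  have hcanti : ∀ x, Antitone fun k => c k x := fun x i j hij =>
    hcle j x _ (hclow i x) fun a ha => by
      refine le_trans ?_ (hcge i x a (hSanti hij ha))
      have : (i : ℝ) * dist x (ξ a) ≤ j * dist x (ξ a) :=
        mul_le_mul_of_nonneg_right (Nat.cast_le.2 hij) dist_nonneg
      linarith
  refine ⟨c, fun x => ⨅ k, c k x, ⟨fun k => ⟨k, LipschitzWith.of_le_add_mul _ fun x x' => ?_⟩, hcC,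
    hcanti, fun x => tendsto_atTop_ciInf (hcanti x) ⟨-C, ?_⟩⟩, fun x => ?_, fun k hk => ?_⟩
  · have hpos : 0 ≤ (k : ℝ) * dist x x' := mul_nonneg k.cast_nonneg dist_nonneg
    rw [NNReal.coe_natCast]
    refine hcle k x _ (by linarith [hclow k x']) fun a ha => ?_
    have h1 := hcge k x' a ha
    have h2 : (k : ℝ) * dist x' (ξ a) ≤ k * (dist x x' + dist x (ξ a)) :=
      mul_le_mul_of_nonneg_left (dist_triangle_left _ _ _) k.cast_nonneg
    rw [mul_add] at h2
    linarith
  · rintro _ ⟨k, rfl⟩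
    exact hclow k x
  -- If `f x < β < u x`, each `k` has some `a k ∈ S k` with `t (a k) - k * dist x (ξ (a k)) > β`. A
  -- cluster point `b` of the `a k` satisfies `ξ b = x` and `t b ≥ β`, contradicting `t b ≤ f (ξ
  -- b)`.
  · by_contra! hlt
    obtain ⟨β, hβf, hβu⟩ := exists_between hlt
    have hex : ∀ k, ∃ a ∈ (S k).1, β < t a - k * dist x (ξ a) := fun k => by
      have hck : β < c k x := hβu.trans_le (ciInf_le ⟨-C, by rintro _ ⟨k, rfl⟩; exact hclow k x⟩ k)
      by_contra! hcon
      exact absurd (hcle k x β ((hflow x).trans hβf.le) hcon) (not_le.2 hck)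
    choose a haS haβ using hex
    have haM : ∀ i k, i < k → a k i ≤ m (S i) i := fun i k hik => by
      have : a k ∈ (S (i + 1)).1 := hSanti (Nat.succ_le_of_lt hik) (haS k)
      rw [hSsucc] at this
      exact this.2
    -- Membership in `S k` bounds the coordinate `i` of `a k` only for `i < k`; the finitely many `k
    -- ≤ i` are absorbed by the sum.
    have hbox : ∀ k, a k ∈ Set.univ.pi fun i =>
        Set.Iic (m (S i) i + ∑ k ∈ Finset.range (i + 1), a k i) := fun k i _ => by
      rcases lt_or_ge i k with h | h
      · exact (haM i k h).trans (Nat.le_add_right _ _)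
      · exact (Finset.single_le_sum (f := fun k => a k i) (fun _ _ => Nat.zero_le _)
          (Finset.mem_range.2 (Nat.lt_succ_of_le h))).trans (Nat.le_add_left _ _)
    obtain ⟨b, -, φ, hφ, hφb⟩ := (isCompact_univ_pi fun i =>
      (Set.finite_Iic (m (S i) i + ∑ k ∈ Finset.range (i + 1), a k i)).isCompact).tendsto_subseq hbox
    have hξb := (hξ.tendsto b).comp hφb
    have htb := (ht.tendsto b).comp hφb
    have hβa : ∀ k, β ≤ t (a k) := fun k => by
      linarith [haβ k, mul_nonneg k.cast_nonneg (dist_nonneg (x := x) (y := ξ (a k))) (α := ℝ)]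
    have hβb : β ≤ t b := ge_of_tendsto' htb fun j => hβa _
    -- From `β < C - k * dist x (ξ (a k))` the distance is at most `(C - β) / k`.
    have hdist : dist x (ξ b) ≤ 0 := by
      refine le_of_tendsto_of_tendsto (tendsto_const_nhds.dist hξb)
        ((tendsto_const_div_atTop_nhds_zero_nat (C - β)).comp hφ.tendsto_atTop)
        ((eventually_gt_atTop 0).mono fun j hj => ?_)
      have hpos : (0 : ℝ) < φ j := Nat.cast_pos.2 (hj.trans_le (hφ.le_apply))
      simp only [Function.comp_apply]
      rw [le_div_iff₀ hpos]
      linarith [haβ (φ j), htup (a (φ j))]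
    have hxb : x = ξ b := dist_le_zero.1 hdist
    have := htf b
    rw [← hxb] at this
    linarith
  -- Points with `ξ a = x` incur no distance cost, so `env (S k) ≤ c k`, and `D (c k)` would give `D
  -- (env (S k))`.
  · refine (S k).2 (hmono _ _ hk fun x => csSup_le (Set.insert_nonempty _ _) ?_)
    rintro r (rfl | ⟨a, ha, hax, rfl⟩)
    · exact hclow k x
    · simpa [hax] using hcge k x a ha

/-! ### Strong duality and attainment -/

theorem isDominated_of_rhoN_le {E : Type*} [MetricSpace E] [PolishSpace E] [MeasurableSpace E]
    [BorelSpace E] [Nonempty E] {α : ProbabilityMeasure E → EReal} (hα : IsCompactPenalty α) {n : ℕ}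
    {f : (Fin n → E) → ℝ} {C r : ℝ} (hf : Measurable f) (hC : ∀ x, |f x| ≤ C)
    (hr : rhoN α n f ≤ (r : EReal)) : IsDominated α n f r := by
  have happrox : ∀ y, r < y → IsDominated α n f y := fun y hy => by
    by_contra hD
    obtain ⟨c, u, hcu, huf, hc⟩ := exists_isLipschitzApprox_of_not
      (D := fun g => IsDominated α n g y) (fun g g' h hle => h.mono hle le_rfl)
      (fun g g' hg hD hle => isDominated_of_le_liminf hα hg hD tendsto_const_nhds hle) hf hC hD
    have hyc : ∀ j, y ≤ iterRho α n (c j) := fun j => by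
      by_contra! hlt
      obtain ⟨K, hK⟩ := hcu.lipschitz j
      exact hc j ((isDominated_iterRho hα hK (hcu.abs_le j)).mono (fun _ => le_rfl) hlt.le)
    have hyu : y ≤ iterRho α n u := ge_of_tendsto' (hcu.tendsto_iterRho hα) hyc
    have := EReal.coe_le_coe_iff.1 ((hcu.iterRho_le_rhoN hα hf hC huf).trans hr)
    linarith
  -- The Fatou property for the constant sequence `f`, with levels decreasing to `r`, reaches the
  -- level `r` itself.
  refine isDominated_of_le_liminf hα (f := fun _ => f) (y := fun j => r + 1 / ((j : ℝ) + 1))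
    (fun _ => hC) (fun j => happrox _ (lt_add_of_pos_right r (by positivity))) ?_ fun x => ?_
  · simpa using (tendsto_one_div_add_atTop_nhds_zero_nat (𝕜 := ℝ)).const_add r
  · rw [liminf_const]

theorem exists_rhoN_eq_coe {E : Type*} [MetricSpace E] [PolishSpace E] [MeasurableSpace E]
    [BorelSpace E] [Nonempty E] {α : ProbabilityMeasure E → EReal} (hα : IsCompactPenalty α) {n : ℕ}
    {f : (Fin n → E) → ℝ} {C : ℝ} (hf : Measurable f) (hC : ∀ x, |f x| ≤ C) :
    ∃ r : ℝ, rhoN α n f = (r : EReal) := by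
  have hup : rhoN α n f ≤ (iterRho α n (fun _ => C) : EReal) :=
    ((isDominated_iterRho hα (f := fun _ => C) (LipschitzWith.const C) fun _ => le_rfl).mono
      (fun x => (abs_le.1 (hC x)).2) le_rfl).rhoN_le hα hf hC
  have happrox : IsLipschitzApprox |C| (fun (_ : ℕ) (_ : Fin n → E) => -C) fun _ => -C :=
    ⟨fun _ => ⟨0, LipschitzWith.const _⟩, fun _ _ => (abs_neg C).le, fun _ => antitone_const,
      fun _ => tendsto_const_nhds⟩
  have hlow := happrox.iterRho_le_rhoN hα hf hC fun x => (abs_le.1 (hC x)).1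
  exact ⟨_, (EReal.coe_toReal (ne_top_of_le_ne_top (EReal.coe_ne_top _) hup)
    (ne_bot_of_le_ne_bot (EReal.coe_ne_bot _) hlow)).symm⟩

theorem theorem1p6 {E : Type*} [TopologicalSpace E] [PolishSpace E] [MeasurableSpace E]
    [BorelSpace E] [Nonempty E] (α : ProbabilityMeasure E → EReal) (hα : IsPenalty α)
    (n : ℕ) (hn : 1 ≤ n) (f : (Fin n → E) → ℝ) (hf : Measurable f)
    (hfb : ∃ C : ℝ, ∀ x, |f x| ≤ C) :
    ∃ r : ℝ, rhoN α n f = (r : EReal) ∧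
      IsLeast {y : ℝ | ∃ Y : (k : Fin n) → (Fin ((k : ℕ) + 1) → E) → ℝ, IsAdmissible α Y ∧
        ∀ x : Fin n → E,
          f x ≤ y + ∑ k : Fin n, Y k (firstCoords ((k : ℕ) + 1) k.isLt x)} r := by
  obtain ⟨C, hC⟩ := hfb
  let _ := TopologicalSpace.metrizableSpaceMetric E
  have hα' := hα.isCompactPenalty
  obtain ⟨r, hr⟩ := exists_rhoN_eq_coe hα' hf hC
  refine ⟨r, hr, ?_, fun y hy => ?_⟩
  · obtain ⟨Y, hY, hle⟩ := (isDominated_of_rhoN_le hα' hf hC hr.le).exists_admissible hα'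
    exact ⟨_, hY, hle⟩
  · obtain ⟨Y, hY, hle⟩ := hy
    have := (IsDominated.of_admissible hα' hC hY hle).rhoN_le hα' hf hC
    rwa [hr, EReal.coe_le_coe_iff] at this
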